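/- \textbf{Setting.} $N$ renewal systems operate in slotted time $t\in\{0,1,2,\dots\}$. System $n$ has a (measurable) action set $\mathcal A^n$. Its timeline is divided into frames by renewal times $0=t^n_0<t^n_1<t^n_2<\cdots$; at time $t^n_k$ it takes a (possibly random, possibly history dependent) decision $\alpha^n_k\in\mathcal A^n$, which determines the joint distribution of the frame duration $T^n_k=t^n_{k+1}-t^n_k\ge 1$ and of the penalties $y^n[t]\in\mathbb R$ and metrics $\mathbf z^n[t]=(z^n_1[t],\dots,z^n_L[t])\in\mathbb R^L$ in the slots $t\in\mathcal T^n_k=\{t^n_k,\dots,t^n_{k+1}-1\}$. Renewal property: given $\alpha^n_k=\alpha$, the outcome $(T^n_k,(y^n[t],\mathbf z^n[t])_{t\in\mathcal T^n_k})$ of the frame is independent of the information of all systems from the slots before $t^n_k$ and has a fixed law depending only on $n$ and $\alpha$. In addition there is an i.i.d. external process $\mathbf d[t]\in\mathbb R^L$, where $\mathbf d[t]$ is independent of everything that happened before slot $t$; put $d_l=\mathbb E[d_l[t]]$. Consider the problem $$\min\ \limsup_{T\to\infty}\frac1T\sum_{t=0}^{T-1}\sum_{n=1}^N\mathbb E[y^n[t]]\quad\text{s.t.}\quad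 \limsup_{T\to\infty}\frac1T\sum_{t=0}^{T-1}\sum_{n=1}^N\mathbb E[z^n_l[t]]\le d_l,\quad l=1,\dots,L, \qquad(\ast)$$ and let $f_*$ be the infimum of the objective over all decision sequences that satisfy the constraints. For $\alpha\in\mathcal A^n$ let $\widehat T^n(\alpha)$, $\widehat y^n(\alpha)$, $\widehat z^n_l(\alpha)$ be the conditional expectations, given $\alpha^n_k=\alpha$, of $T^n_k$, $\sum_{t\in\mathcal T^n_k}y^n[t]$ and $\sum_{t\in\mathcal T^n_k}z^n_l[t]$. \textbf{Assumptions.} (1) The problem $(\ast)$ is feasible. (2) There are constants with $|y^n[t]|\le y_{\max}$, $|z^n_l[t]|\le z_{\max}$, $|d_l[t]|\le d_{\max}$ almost surely, and a constant $B\ge1$ such that $\mathbb E[(T^n_k-s)^2\mid \alpha^n_k=\alpha,\,T^n_k\ge s]\le B$ for all $n$, all $\alpha\in\mathcal A^n$ and all $s\in\{0,1,2,\dots\}$ with $\Pr(T^n_k\ge s\mid\alpha^n_k=\alpha)>0$. (3) For each $n$ the set $\{(\widehat y^n(\alpha)/\widehat T^n(\alpha),\ \widehat{\mathbf z}^n(\alpha)/\widehat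 T^n(\alpha)):\alpha\in\mathcal A^n\}\subset\mathbb R^{L+1}$ is compact. \textbf{Algorithm.} Fix $V>0$. Let the virtual queues be $Q_l[0]=0$, $Q_l[t+1]=\max\{Q_l[t]+\sum_{n=1}^N z^n_l[t]-d_l[t],\,0\}$. At each renewal $t^n_k$, system $n$ chooses $\alpha^n_k$ as a minimizer over $\alpha\in\mathcal A^n$ of $$\frac{V\,\widehat y^n(\alpha)+\sum_{l=1}^L Q_l[t^n_k]\,\widehat z^n_l(\alpha)}{\widehat T^n(\alpha)}.$$ \textbf{Theorem.} Under assumptions (1)--(3), the sequences $y^n[t]$, $\mathbf z^n[t]$ produced by the algorithm satisfy $\lim_{T\to\infty}\mathbb E[Q_l[T]]/T=0$ for every $l$, they satisfy all the constraints in $(\ast)$, and $$\limsup_{T\to\infty}\frac1T\sum_{t=0}^{T-1}\sum_{n=1}^N\mathbb E[y^n[t]]\ \le\ f_*+\frac{NC_1+C_3}{V},$$ where $C_1=6Lz_{\max}(Nz_{\max}+d_{\max})B$ and $C_3=\tfrac12(Nz_{\max}+d_{\max})^2L$. -/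

import Mathlib

open MeasureTheory ProbabilityTheory Filter Topology
open scoped ENNReal

universe u v

noncomputable section

namespace AsyncRenewal

/-- The outcome of one renewal frame with `L` performance metrics: its duration `T` and, for each of
its `T` slots, the penalty and the vector of performance metrics of that slot. -/
abbrev Frame (L : ℕ) : Type := Σ T : ℕ, Fin T → ℝ × (Fin L → ℝ)

/-- The data of `N` parallel renewal systems with `L` performance metrics: the action sets `𝒜ⁿ`, the
law of a frame outcome under each action (durations are positive integers), and the law of the
external process in one slot. -/
structure Systems (N L : ℕ) where
  Action : Fin N → Type u
  [measurableSpaceAction : ∀ n, MeasurableSpace (Action n)]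
  frameLaw : ∀ n, Kernel (Action n) (Frame L)
  [isMarkovKernel_frameLaw : ∀ n, IsMarkovKernel (frameLaw n)]
  duration_pos : ∀ n a, ∀ᵐ F ∂(frameLaw n a), 1 ≤ F.1
  extLaw : Measure (Fin L → ℝ)
  [isProbabilityMeasure_extLaw : IsProbabilityMeasure extLaw]

attribute [instance] Systems.measurableSpaceAction Systems.isMarkovKernel_frameLaw
  Systems.isProbabilityMeasure_extLaw

namespace Systems

variable {N L : ℕ} (S : Systems.{u} N L)

/-- The mean `d_l` of the external process. -/
def extMean (l : Fin L) : ℝ := ∫ x, x l ∂S.extLaw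

/-- `T̂ⁿ(a)`: expected frame duration under action `a`. -/
def meanDuration (n : Fin N) (a : S.Action n) : ℝ := ∫ F, (F.1 : ℝ) ∂(S.frameLaw n a)

/-- `ŷⁿ(a)`: expected total penalty of a frame under action `a`. -/
def meanPenalty (n : Fin N) (a : S.Action n) : ℝ := ∫ F, ∑ i, (F.2 i).1 ∂(S.frameLaw n a)

/-- `ẑⁿ_l(a)`: expected total of metric `l` over a frame under action `a`. -/
def meanMetric (n : Fin N) (a : S.Action n) (l : Fin L) : ℝ :=
  ∫ F, ∑ i, (F.2 i).2 l ∂(S.frameLaw n a)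

/-- The performance vector `(f̂ⁿ(a), ĝⁿ(a)) = (ŷⁿ(a) / T̂ⁿ(a), ẑⁿ(a) / T̂ⁿ(a))`. -/
def performance (n : Fin N) (a : S.Action n) : ℝ × (Fin L → ℝ) :=
  (S.meanPenalty n a / S.meanDuration n a, fun l => S.meanMetric n a l / S.meanDuration n a)

/-- The drift-plus-penalty ratio of action `a` with trade-off parameter `V` and queue vector `q`. -/
def dppRatio (V : ℝ) (q : Fin L → ℝ) (n : Fin N) (a : S.Action n) : ℝ :=
  (V * S.meanPenalty n a + ∑ l, q l * S.meanMetric n a l) / S.meanDuration n a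

/-- Boundedness: penalties, metrics and external process are bounded by `ymax`, `zmax`, `dmax`, and
the residual life of a frame has conditional second moment
`E[(T - s)² | T ≥ s] ≤ B` for each action and each `s` with `Pr(T ≥ s) > 0`. -/
structure Bounded (ymax zmax dmax B : ℝ) : Prop where
  penalty_le : ∀ n a, ∀ᵐ F ∂(S.frameLaw n a), ∀ i, |(F.2 i).1| ≤ ymax
  metric_le : ∀ n a, ∀ᵐ F ∂(S.frameLaw n a), ∀ i l, |(F.2 i).2 l| ≤ zmax
  ext_le : ∀ᵐ x ∂S.extLaw, ∀ l, |x l| ≤ dmax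
  one_le : 1 ≤ B
  residual_le : ∀ n a (s : ℕ), 0 < S.frameLaw n a {F | s ≤ F.1} →
    ∫⁻ F, ENNReal.ofReal (((F.1 : ℝ) - s) ^ 2) ∂((S.frameLaw n a)[|{F | s ≤ F.1}])
      ≤ ENNReal.ofReal B

end Systems

/-- A realization of the renewal systems `S` on a probability space, under some causal, possibly
randomized and history dependent choice of the actions.
* `time n k` is the slot `tⁿ_k` of the `k`-th renewal of system `n`;
* `action n k` is the decision taken at the start of the `k`-th frame of system `n`;
* `penalty n t`, `metric n t`, `ext t` are `yⁿ[t]`, `zⁿ[t]` and `d[t]`;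
* `history t` is the information of all systems from the slots before `t` (that a renewal takes
  place at the start of slot `t` is known from the slots before `t`). -/
structure Realization {N L : ℕ} (S : Systems.{u} N L) {Ω : Type v} [mΩ : MeasurableSpace Ω]
    (P : Measure Ω) where
  history : Filtration ℕ mΩ
  time : Fin N → ℕ → Ω → ℕ
  action : ∀ n, ℕ → Ω → S.Action n
  penalty : Fin N → ℕ → Ω → ℝ
  metric : Fin N → ℕ → Ω → Fin L → ℝ
  ext : ℕ → Ω → Fin L → ℝ
  time_zero : ∀ n ω, time n 0 ω = 0
  time_lt : ∀ n k ω, time n k ω < time n (k + 1) ω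
  isStoppingTime_time : ∀ n k, IsStoppingTime history fun ω => ((time n k ω : ℕ) : WithTop ℕ)
  measurable_action : ∀ n k, Measurable (action n k)
  /-- an action taken in slot `t` or before belongs to the information of the slots up to `t` -/
  action_history : ∀ n k t (A : Set (S.Action n)), MeasurableSet A →
    MeasurableSet[history (t + 1)] ({ω | time n k ω ≤ t} ∩ action n k ⁻¹' A)
  penalty_history : ∀ n t, Measurable[history (t + 1)] (penalty n t)
  metric_history : ∀ n t, Measurable[history (t + 1)] (metric n t)
  ext_history : ∀ t, Measurable[history (t + 1)] (ext t)
  /-- the external process is i.i.d. and uncontrollable: `d[t]` has the given law and is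
  independent of everything that happened before slot `t` -/
  ext_law : ∀ t, P.map (ext t) = S.extLaw
  ext_indep : ∀ t, Indep (MeasurableSpace.comap (ext t) inferInstance) (history t) P
  /-- renewal property: given the decision `a` at the start of a frame, the outcome of the frame is
  independent of the information of all systems before the frame and has law `frameLaw n a`; that
  is, `frameLaw n (action n k)` is a conditional law of the outcome given the stopped
  `σ`-algebra at `time n k` and the action. -/
  renewal : ∀ n k (A : Set Ω),
    MeasurableSet[(isStoppingTime_time n k).measurableSpace ⊔
      MeasurableSpace.comap (action n k) inferInstance] A →
    ∀ E : Set (Frame L), MeasurableSet E →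
      P (A ∩ {ω | (⟨time n (k + 1) ω - time n k ω, fun i =>
          (penalty n (time n k ω + i) ω, metric n (time n k ω + i) ω)⟩ : Frame L) ∈ E})
        = ∫⁻ ω in A, S.frameLaw n (action n k ω) E ∂P

namespace Realization

variable {N L : ℕ} {S : Systems.{u} N L} {Ω : Type v} [MeasurableSpace Ω] {P : Measure Ω}
  (X : Realization S P)

/-- `limsup_T (1/T) ∑_{t<T} ∑_n E[yⁿ[t]]`. -/
def avgPenalty : EReal :=
  limsup (fun T : ℕ => (((1 / (T : ℝ)) *
    ∑ t ∈ Finset.range T, ∑ n, ∫ ω, X.penalty n t ω ∂P : ℝ) : EReal)) atTop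

/-- `limsup_T (1/T) ∑_{t<T} ∑_n E[zⁿ_l[t]]`. -/
def avgMetric (l : Fin L) : EReal :=
  limsup (fun T : ℕ => (((1 / (T : ℝ)) *
    ∑ t ∈ Finset.range T, ∑ n, ∫ ω, X.metric n t ω l ∂P : ℝ) : EReal)) atTop

/-- All time average constraints hold. -/
def Feasible : Prop := ∀ l, X.avgMetric l ≤ (S.extMean l : EReal)

/-- The virtual queues: `Q_l[0] = 0`, `Q_l[t+1] = max (Q_l[t] + ∑_n zⁿ_l[t] - d_l[t]) 0`. -/
def queue : ℕ → Ω → Fin L → ℝ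
  | 0, _, _ => 0
  | t + 1, ω, l => max (queue t ω l + ∑ n, X.metric n t ω l - X.ext t ω l) 0

/-- The realization results from the proposed algorithm with parameter `V`: each system minimizes, at
each of its renewals, the drift-plus-penalty ratio for the current virtual queues. -/
def FollowsAlgorithm (V : ℝ) : Prop :=
  ∀ n k, ∀ᵐ ω ∂P, ∀ a : S.Action n,
    S.dppRatio V (X.queue (X.time n k ω) ω) n (X.action n k ω)
      ≤ S.dppRatio V (X.queue (X.time n k ω) ω) n a

end Realization

namespace Systems

variable {N L : ℕ} (S : Systems.{u} N L)

/-- The objective values of the realizations of `S` that satisfy the constraints. -/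
def feasibleValues : Set EReal :=
  {v | ∃ (Ω : Type u) (_ : MeasurableSpace Ω) (P : Measure Ω) (_ : IsProbabilityMeasure P)
    (X : Realization S P), X.Feasible ∧ X.avgPenalty = v}

/-- `f_*`, the optimal value. -/
def optimalValue : EReal := sInf S.feasibleValues

end Systems

end AsyncRenewal

end

/-! The optimum is replaced by a static reference. For a feasible realization, a subsequence of the
time averages of the individual systems converges to numbers `f n`, `g n l`, with `∑ n, f n` at most
its objective and `∑ n, g n l ≤ d_l`. By the renewal property, every linear functional of such a
limit is at least its infimum over the performance vectors of the actions
(`exists_limit_performance`). This one-sided inequality is all that is used of convexity. At a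
renewal it applies with weights `V` and the current queues: the minimal ratio is at most `V * f + ∑
l, Q_l * g l`. Hence, with queues frozen at its start, a frame of the algorithm does in mean no
worse than the reference over the same number of slots (`integral_frozenTotal_nonpos`).

Two errors remain, because the systems renew asynchronously. First, queues move during a frame, by
at most `i * (N * zmax + dmax)` after `i` slots; a frame of duration `D` thus costs at most `c * D ^
2`, where `c = zmax * L * (N * zmax + dmax)`, with mean at most `c * B`. At most `T` frames of a
system start before `T`. Second, the horizon `T` cuts a frame. Whether a frame starts before `T` is
known at its start, so all started frames are summed in full and the overshoot `R` beyond `T` is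
subtracted. The residual-life assumption gives `E[R ^ 2] ≤ B` (`integrable_residual_sq`). The
overshoot also produces products `R * Q_l[T]`, which Young's inequality splits into a constant and a
part absorbed by the Lyapunov function.

Together with the drift of `∑ l, Q_l ^ 2 / 2` this yields `exists_penalty_add_queue_sq_le`: `V`
times the accumulated mean penalty plus `∑ l, E[Q_l[T] ^ 2] / 4` is at most `T * (C₃ + N * c * B + V
* ∑ n, f n) + K`. Dropping the queues and dividing by `V * T` bounds the objective, as `c * B ≤ C₁`.
Bounding the penalties below instead gives `E[Q_l[T] ^ 2] = O(T)`, hence stability and the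
constraints. -/

noncomputable section

namespace AsyncRenewal

/-! ### Measurability on the space of frames -/

theorem measurable_frame_mk {L : ℕ} (T : ℕ) :
    Measurable fun x : Fin T → ℝ × (Fin L → ℝ) => (⟨T, x⟩ : Frame L) := by
  intro s hs
  exact (MeasurableSpace.measurableSet_iInf.1 hs) T

theorem measurable_of_frame {L : ℕ} {γ : Type*} [MeasurableSpace γ] {f : Frame L → γ}
    (h : ∀ T, Measurable fun x : Fin T → ℝ × (Fin L → ℝ) => f ⟨T, x⟩) : Measurable f := by
  intro s hs
  exact MeasurableSpace.measurableSet_iInf.2 fun T => h T hs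

theorem measurable_frame_duration {L : ℕ} : Measurable fun F : Frame L => F.1 :=
  measurable_of_frame fun _ => measurable_const

theorem measurable_frame_sum {L : ℕ} {φ : ℝ × (Fin L → ℝ) → ℝ} (hφ : Measurable φ) :
    Measurable fun F : Frame L => ∑ i, φ (F.2 i) :=
  measurable_of_frame fun T => by
    exact Finset.measurable_sum Finset.univ fun i _ => hφ.comp (measurable_pi_apply i)

theorem measurableSet_frame_forall {L : ℕ} {A : Set (ℝ × (Fin L → ℝ))} (hA : MeasurableSet A) :
    MeasurableSet {F : Frame L | ∀ i, F.2 i ∈ A} := by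
  refine MeasurableSpace.measurableSet_iInf.2 fun T => ?_
  change MeasurableSet {x : Fin T → ℝ × (Fin L → ℝ) | ∀ i, x i ∈ A}
  rw [Set.ofPred_forall]
  exact MeasurableSet.iInter fun i => measurable_pi_apply i hA

theorem integrable_integral_bind {α β : Type*} [MeasurableSpace α] [MeasurableSpace β]
    {μ : Measure α} [SFinite μ] {κ : Kernel α β} [IsSFiniteKernel κ] {f : β → ℝ}
    (hf : Integrable f (μ.bind κ)) : Integrable (fun a => ∫ b, f b ∂(κ a)) μ := by
  rw [Measure.comp_eq_comp_const_apply] at hf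
  exact hf.integral_comp

theorem integral_bind_kernel {α β : Type*} [MeasurableSpace α] [MeasurableSpace β]
    {μ : Measure α} [SFinite μ] {κ : Kernel α β} [IsSFiniteKernel κ] {f : β → ℝ}
    (hf : Integrable f (μ.bind κ)) : ∫ b, f b ∂(μ.bind κ) = ∫ a, ∫ b, f b ∂(κ a) ∂μ := by
  rw [Measure.comp_eq_comp_const_apply] at hf ⊢
  exact Kernel.integral_comp hf

/-! ### The renewal property as a conditional law -/

namespace Realization

variable {N L : ℕ} {S : Systems.{u} N L} {Ω : Type v} [mΩ : MeasurableSpace Ω] {P : Measure Ω}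
  (X : Realization S P)

/-- The outcome of the `k`-th frame of system `n`. -/
def frame (n : Fin N) (k : ℕ) (ω : Ω) : Frame L :=
  ⟨X.time n (k + 1) ω - X.time n k ω, fun i =>
    (X.penalty n (X.time n k ω + i) ω, X.metric n (X.time n k ω + i) ω)⟩

/-- The information available right after the `k`-th decision of system `n`. -/
abbrev info (n : Fin N) (k : ℕ) : MeasurableSpace Ω :=
  (X.isStoppingTime_time n k).measurableSpace ⊔ MeasurableSpace.comap (X.action n k) inferInstance

theorem info_le (n : Fin N) (k : ℕ) : X.info n k ≤ mΩ :=
  sup_le (IsStoppingTime.measurableSpace_le _) (X.measurable_action n k).comap_le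

theorem measurable_action_info (n : Fin N) (k : ℕ) : Measurable[X.info n k] (X.action n k) :=
  (comap_measurable (X.action n k)).mono le_sup_right le_rfl

theorem measurableSet_time_eq (n : Fin N) (k j : ℕ) :
    MeasurableSet[X.history j] {ω | X.time n k ω = j} := by
  have := (X.isStoppingTime_time n k).measurableSet_eq j
  simpa using this

theorem measurableSet_info_time_eq (n : Fin N) (k j : ℕ) :
    MeasurableSet[X.info n k] {ω | X.time n k ω = j} := by
  have := (X.isStoppingTime_time n k).measurableSet_eq' j
  refine (le_sup_left : _ ≤ X.info n k) _ ?_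
  simpa using this

theorem measurable_time_info (n : Fin N) (k : ℕ) : Measurable[X.info n k] (X.time n k) :=
  @measurable_to_countable' _ _ _ _ (X.info n k) _ fun j => X.measurableSet_info_time_eq n k j

theorem measurable_time (n : Fin N) (k : ℕ) : Measurable (X.time n k) :=
  (X.measurable_time_info n k).mono (X.info_le n k) le_rfl

theorem measurable_penalty (n : Fin N) (t : ℕ) : Measurable (X.penalty n t) :=
  (X.penalty_history n t).mono (X.history.le _) le_rfl

theorem measurable_metric (n : Fin N) (t : ℕ) : Measurable (X.metric n t) :=
  (X.metric_history n t).mono (X.history.le _) le_rfl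

theorem measurable_ext (t : ℕ) : Measurable (X.ext t) :=
  (X.ext_history t).mono (X.history.le _) le_rfl

theorem measurable_frame (n : Fin N) (k : ℕ) : Measurable (X.frame n k) := by
  have h : Measurable fun p : (ℕ × ℕ) × Ω => (⟨p.1.2 - p.1.1, fun i =>
      (X.penalty n (p.1.1 + i) p.2, X.metric n (p.1.1 + i) p.2)⟩ : Frame L) := by
    refine measurable_from_prod_countable_right fun p => ?_
    refine (measurable_frame_mk (p.2 - p.1)).comp (measurable_pi_lambda _ fun i => ?_)
    exact (X.measurable_penalty n (p.1 + i)).prodMk (X.measurable_metric n (p.1 + i))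
  exact h.comp (((X.measurable_time n k).prodMk (X.measurable_time n (k + 1))).prodMk measurable_id)

/-- A process adapted to the history, evaluated at a renewal, is known at that renewal. -/
theorem measurable_info_stopped (n : Fin N) (k : ℕ) {f : ℕ → Ω → ℝ}
    (hf : ∀ t, Measurable[X.history t] (f t)) :
    Measurable[X.info n k] fun ω => f (X.time n k ω) ω := by
  refine Measurable.mono (ma := (X.isStoppingTime_time n k).measurableSpace) ?_ le_sup_left le_rfl
  intro A hA
  have hset : ∀ j : ℕ, MeasurableSet[X.history j]
      ((fun ω => f (X.time n k ω) ω) ⁻¹' A ∩ {ω | X.time n k ω = j}) := by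
    intro j
    have : ((fun ω => f (X.time n k ω) ω) ⁻¹' A ∩ {ω | X.time n k ω = j})
        = f j ⁻¹' A ∩ {ω | X.time n k ω = j} := by
      ext ω
      simp only [Set.mem_inter_iff, Set.mem_preimage, Set.mem_ofPred_eq]
      constructor <;> rintro ⟨h, rfl⟩ <;> exact ⟨h, rfl⟩
    rw [this]
    exact (hf j hA).inter (X.measurableSet_time_eq n k j)
  have hle : ∀ i : ℕ, MeasurableSet[X.history i]
      ((fun ω => f (X.time n k ω) ω) ⁻¹' A ∩ {ω | ((X.time n k ω : ℕ) : WithTop ℕ) ≤ i}) := by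
    intro i
    have : ((fun ω => f (X.time n k ω) ω) ⁻¹' A ∩ {ω | ((X.time n k ω : ℕ) : WithTop ℕ) ≤ i})
        = ⋃ j ∈ Set.Iic i, ((fun ω => f (X.time n k ω) ω) ⁻¹' A ∩ {ω | X.time n k ω = j}) := by
      ext ω
      simp
    rw [this]
    exact MeasurableSet.biUnion (Set.to_countable _)
      fun j hj => X.history.mono hj _ (hset j)
  refine ⟨?_, hle⟩
  have : ((fun ω => f (X.time n k ω) ω) ⁻¹' A)
      = ⋃ j, ((fun ω => f (X.time n k ω) ω) ⁻¹' A ∩ {ω | X.time n k ω = j}) := by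
    ext ω
    simp
  rw [this]
  exact MeasurableSet.iUnion fun j => (le_iSup X.history j) _ (hset j)

/-- Given the decision, a frame has the prescribed law whatever happened before. -/
theorem map_frame_restrict (n : Fin N) (k : ℕ) {A : Set Ω} (hA : MeasurableSet[X.info n k] A) :
    (P.restrict A).map (X.frame n k)
      = (P.restrict A).bind ((S.frameLaw n).comap (X.action n k) (X.measurable_action n k)) := by
  ext E hE
  rw [Measure.map_apply (X.measurable_frame n k) hE, Measure.bind_apply hE (Kernel.aemeasurable _),
    Measure.restrict_apply (X.measurable_frame n k hE), Set.inter_comm]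
  exact X.renewal n k A hA E hE

theorem setLIntegral_frame (n : Fin N) (k : ℕ) {A : Set Ω} (hA : MeasurableSet[X.info n k] A)
    {h : Frame L → ℝ≥0∞} (hh : Measurable h) :
    ∫⁻ ω in A, h (X.frame n k ω) ∂P
      = ∫⁻ ω in A, ∫⁻ F, h F ∂(S.frameLaw n (X.action n k ω)) ∂P := by
  rw [← lintegral_map hh (X.measurable_frame n k), X.map_frame_restrict n k hA,
    Measure.lintegral_bind (Kernel.aemeasurable _) hh.aemeasurable]
  rfl

theorem ae_frame (n : Fin N) (k : ℕ) {E : Set (Frame L)} (hE : MeasurableSet E)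
    (h : ∀ a, ∀ᵐ F ∂(S.frameLaw n a), F ∈ E) : ∀ᵐ ω ∂P, X.frame n k ω ∈ E := by
  have h1 := X.renewal n k Set.univ MeasurableSet.univ Eᶜ hE.compl
  have h2 : ∀ ω, S.frameLaw n (X.action n k ω) Eᶜ = 0 := fun ω => h _
  simp only [Set.univ_inter, h2, lintegral_zero] at h1
  exact h1

/-- On each event known at the decision, the law of the frame is the mixture of `frameLaw` over the
chosen actions; so the kernel integral has the defining set integrals of a conditional expectation.
-/
theorem condExp_frame [IsProbabilityMeasure P] (n : Fin N) (k : ℕ) {h : Frame L → ℝ}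
    (hh : Measurable h) (hint : Integrable (fun ω => h (X.frame n k ω)) P) :
    (fun ω => ∫ F, h F ∂(S.frameLaw n (X.action n k ω)))
      =ᵐ[P] P[fun ω => h (X.frame n k ω) | X.info n k] := by
  have key : ∀ A, MeasurableSet[X.info n k] A →
      IntegrableOn (fun ω => ∫ F, h F ∂(S.frameLaw n (X.action n k ω))) A P ∧
      ∫ ω in A, ∫ F, h F ∂(S.frameLaw n (X.action n k ω)) ∂P
        = ∫ ω in A, h (X.frame n k ω) ∂P := by
    intro A hA
    have h1 : Integrable h ((P.restrict A).map (X.frame n k)) :=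
      (integrable_map_measure hh.aestronglyMeasurable
        (X.measurable_frame n k).aemeasurable).2 hint.integrableOn
    have h2 : ∫ F, h F ∂((P.restrict A).map (X.frame n k)) = ∫ ω in A, h (X.frame n k ω) ∂P :=
      integral_map (X.measurable_frame n k).aemeasurable hh.aestronglyMeasurable
    rw [X.map_frame_restrict n k hA] at h1 h2
    exact ⟨integrable_integral_bind h1, (integral_bind_kernel h1).symm.trans h2⟩
  refine ae_eq_condExp_of_forall_setIntegral_eq (X.info_le n k) hint
    (fun A hA _ => (key A hA).1) (fun A hA _ => (key A hA).2) ?_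
  have h1 : StronglyMeasurable fun a => ∫ F, h F ∂(S.frameLaw n a) :=
      hh.stronglyMeasurable.integral_kernel
  exact (h1.comp_measurable (X.measurable_action_info n k)).aestronglyMeasurable

/-- The mean of the outcome of a frame, weighted by a bounded quantity known when it starts. -/
theorem integral_mul_frame [IsProbabilityMeasure P] (n : Fin N) (k : ℕ) {h : Frame L → ℝ}
    (hh : Measurable h) (hint : Integrable (fun ω => h (X.frame n k ω)) P) {W : Ω → ℝ}
    (hW : Measurable[X.info n k] W) (c : ℝ) (hc : ∀ᵐ ω ∂P, |W ω| ≤ c) :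
    Integrable (fun ω => W ω * h (X.frame n k ω)) P ∧
    Integrable (fun ω => W ω * ∫ F, h F ∂(S.frameLaw n (X.action n k ω))) P ∧
    ∫ ω, W ω * h (X.frame n k ω) ∂P
      = ∫ ω, W ω * ∫ F, h F ∂(S.frameLaw n (X.action n k ω)) ∂P := by
  have hWm : AEStronglyMeasurable W P :=
    (hW.mono (X.info_le n k) le_rfl).aestronglyMeasurable
  have h0 := X.condExp_frame n k hh hint
  have h1 : P[fun ω => W ω * h (X.frame n k ω) | X.info n k]
      =ᵐ[P] fun ω => W ω * ∫ F, h F ∂(S.frameLaw n (X.action n k ω)) := by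
    refine (condExp_stronglyMeasurable_mul_of_bound (X.info_le n k)
      (Measurable.stronglyMeasurable hW) hint c hc).trans ?_
    filter_upwards [h0] with ω hω
    simp only [Pi.mul_apply, hω]
  refine ⟨hint.bdd_mul hWm hc, ?_, ?_⟩
  · exact integrable_condExp.congr h1
  · rw [← integral_condExp (X.info_le n k), integral_congr_ae h1]

end Realization

/-! ### Deterministic bookkeeping of renewal times -/

/-- For renewal times `τ`, the amount by which the last of the frames started before `T`
exceeds `T`. -/
def overshoot (τ : ℕ → ℕ) (T : ℕ) : ℕ :=
  ∑ k ∈ Finset.range T, if τ k < T then τ (k + 1) - T else 0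

section Path

variable {τ : ℕ → ℕ}

/-- Frames last at least one slot, so `k ≤ τ k`. Sums over the random set of started frames can
therefore run over the deterministic set `Finset.range T`. -/
theorem exists_frame_count (h0 : τ 0 = 0) (hτ : StrictMono τ) (T : ℕ) :
    ∃ K ≤ T, (∀ k, τ k < T ↔ k < K) ∧ T ≤ τ K ∧ (0 < T → 0 < K) := by
  have hex : ∃ k, T ≤ τ k := ⟨T, hτ.le_apply⟩
  refine ⟨Nat.find hex, Nat.find_min' hex hτ.le_apply, fun k => ?_, Nat.find_spec hex, fun hT => ?_⟩
  · constructor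
    · intro hk
      by_contra hlt
      have := hτ.monotone (not_lt.1 hlt)
      have := Nat.find_spec hex
      omega
    · intro hk
      have := Nat.find_min hex hk
      omega
  · rw [Nat.pos_iff_ne_zero]
    intro h
    have := Nat.find_spec hex
    rw [h, h0] at this
    omega

theorem sum_started_eq {M : Type*} [AddCommMonoid M] {T K : ℕ} (hK : K ≤ T)
    (h : ∀ k, τ k < T ↔ k < K) (g : ℕ → M) :
    (∑ k ∈ Finset.range T, if τ k < T then g k else 0) = ∑ k ∈ Finset.range K, g k := by
  rw [← Finset.sum_filter]
  refine Finset.sum_congr ?_ fun _ _ => rfl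
  ext k
  simp only [Finset.mem_filter, Finset.mem_range, h]
  omega

/-- The last started frame is the only one to reach `T`; it may end exactly at `T`, with overshoot
zero. Earlier frames contribute zero to `overshoot` by truncated subtraction. -/
theorem exists_straddling (h0 : τ 0 = 0) (hτ : StrictMono τ) {T : ℕ} (hT : 0 < T) :
    ∃ J < T, τ J < T ∧ T ≤ τ (J + 1) ∧ T + overshoot τ T = τ (J + 1) ∧
      ∀ k, k ≠ J → ¬ (τ k < T ∧ T ≤ τ (k + 1)) := by
  obtain ⟨K, hKT, hK, hTK, hpos⟩ := exists_frame_count h0 hτ T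
  obtain ⟨J, rfl⟩ : ∃ J, K = J + 1 := ⟨K - 1, by have := hpos hT; omega⟩
  refine ⟨J, by omega, (hK J).2 (by omega), hTK, ?_, fun k hk => ?_⟩
  · rw [overshoot, sum_started_eq hKT hK fun k => τ (k + 1) - T, Finset.sum_range_succ,
      Finset.sum_eq_zero]
    · omega
    · intro k hk
      have := (hK (k + 1)).2 (by have := Finset.mem_range.1 hk; omega)
      omega
  · rintro ⟨h1, h2⟩
    have h3 := (hK k).1 h1
    have h4 := (hK (k + 1)).not.1 (by omega)
    omega

theorem sum_range_eq_sum_frames (h0 : τ 0 = 0) (hτ : StrictMono τ) (f : ℕ → ℝ) (K : ℕ) :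
    ∑ k ∈ Finset.range K, ∑ i ∈ Finset.range (τ (k + 1) - τ k), f (τ k + i)
      = ∑ t ∈ Finset.range (τ K), f t := by
  induction K with
  | zero => simp [h0]
  | succ K ih =>
    rw [Finset.sum_range_succ, ih, ← Finset.sum_range_add_sum_Ico f (hτ (Nat.lt_succ_self K)).le,
      Finset.sum_Ico_eq_sum_range]

theorem sum_started_frames (h0 : τ 0 = 0) (hτ : StrictMono τ) (f : ℕ → ℝ) (T : ℕ) :
    (∑ k ∈ Finset.range T,
      if τ k < T then ∑ i ∈ Finset.range (τ (k + 1) - τ k), f (τ k + i) else 0)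
      = ∑ t ∈ Finset.range T, f t + ∑ i ∈ Finset.range (overshoot τ T), f (T + i) := by
  rcases Nat.eq_zero_or_pos T with rfl | hT
  · simp [overshoot]
  obtain ⟨K, hKT, hK, hTK, hpos⟩ := exists_frame_count h0 hτ T
  obtain ⟨J, hJ, hJ1, hJ2, hJ3, -⟩ := exists_straddling h0 hτ hT
  have : J + 1 = K := by
    have h1 := (hK J).1 hJ1
    have h2 := (hK (J + 1)).not.1 (by omega)
    omega
  rw [sum_started_eq hKT hK fun k => ∑ i ∈ Finset.range (τ (k + 1) - τ k), f (τ k + i),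
    sum_range_eq_sum_frames h0 hτ, ← this, ← hJ3, Finset.sum_range_add]

/-- Every slot belongs to a frame. -/
theorem exists_frame_slot (h0 : τ 0 = 0) (hτ : StrictMono τ) (t : ℕ) :
    ∃ k, ∃ i < τ (k + 1) - τ k, t = τ k + i := by
  obtain ⟨J, -, h1, h2, -⟩ := exists_straddling h0 hτ (Nat.succ_pos t)
  exact ⟨J, t - τ J, by omega, by omega⟩

end Path

/-! ### Second moments of durations and overshoots -/

theorem Systems.Bounded.setLIntegral_residual_le {N L : ℕ} {S : Systems.{u} N L}
    {ymax zmax dmax B : ℝ} (hS : S.Bounded ymax zmax dmax B) (n : Fin N) (a : S.Action n) (s : ℕ) :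
    ∫⁻ F in {F | s ≤ F.1}, ENNReal.ofReal (((F.1 : ℝ) - s) ^ 2) ∂(S.frameLaw n a)
      ≤ ENNReal.ofReal B * S.frameLaw n a {F | s ≤ F.1} := by
  rcases eq_or_ne (S.frameLaw n a {F | s ≤ F.1}) 0 with h | h
  · rw [Measure.restrict_eq_zero.2 h]
    simp
  · have := hS.residual_le n a s (pos_iff_ne_zero.2 h)
    rw [ProbabilityTheory.cond, lintegral_smul_measure, smul_eq_mul] at this
    rwa [ENNReal.inv_mul_le_iff h (measure_ne_top _ _), mul_comm] at this

namespace Realization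

variable {N L : ℕ} {S : Systems.{u} N L} {Ω : Type v} [mΩ : MeasurableSpace Ω] {P : Measure Ω}
  (X : Realization S P) {ymax zmax dmax B : ℝ}

theorem strictMono_time (n : Fin N) (ω : Ω) : StrictMono fun k => X.time n k ω :=
  strictMono_nat_of_lt_succ fun k => X.time_lt n k ω

/-- The residual-life bound is uniform in the action, so it can be integrated over the chosen
actions on any event known at the decision. -/
theorem setLIntegral_residual_le (hS : S.Bounded ymax zmax dmax B) (n : Fin N) (k s : ℕ)
    {A : Set Ω} (hA : MeasurableSet[X.info n k] A) :
    ∫⁻ ω in A ∩ {ω | s ≤ (X.frame n k ω).1}, ENNReal.ofReal (((X.frame n k ω).1 - s : ℝ) ^ 2) ∂P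
      ≤ ENNReal.ofReal B * P (A ∩ {ω | s ≤ (X.frame n k ω).1}) := by
  have hD : MeasurableSet {F : Frame L | s ≤ F.1} := measurable_frame_duration measurableSet_Ici
  have hD' : MeasurableSet {ω | s ≤ (X.frame n k ω).1} := X.measurable_frame n k hD
  have hh : Measurable fun F : Frame L => ENNReal.ofReal (((F.1 : ℝ) - s) ^ 2) := by
    have : Measurable fun F : Frame L => (F.1 : ℝ) :=
      measurable_from_top.comp measurable_frame_duration
    fun_prop
  have h1 := X.setLIntegral_frame n k hA (hh.indicator hD)
  have h2 : ∫⁻ ω in A ∩ {ω | s ≤ (X.frame n k ω).1},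
      ENNReal.ofReal (((X.frame n k ω).1 - s : ℝ) ^ 2) ∂P
      = ∫⁻ ω in A, ({F : Frame L | s ≤ F.1}.indicator
          fun F : Frame L => ENNReal.ofReal (((F.1 : ℝ) - s) ^ 2)) (X.frame n k ω) ∂P := by
    rw [Set.inter_comm, ← Measure.restrict_restrict hD', ← lintegral_indicator hD']
    rfl
  rw [h2, h1]
  have h3 : P (A ∩ {ω | s ≤ (X.frame n k ω).1})
      = ∫⁻ ω in A, S.frameLaw n (X.action n k ω) {F | s ≤ F.1} ∂P := X.renewal n k A hA _ hD
  rw [h3, ← lintegral_const_mul]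
  · refine lintegral_mono fun ω => ?_
    simp only
    rw [lintegral_indicator hD]
    exact hS.setLIntegral_residual_le n _ s
  · exact (Kernel.measurable_coe _ hD).comp (X.measurable_action n k)

theorem integrable_of_lintegral_ofReal_le {f : Ω → ℝ} (hf : Measurable f) (h0 : ∀ ω, 0 ≤ f ω)
    {c : ℝ} (hc : 0 ≤ c) (h : ∫⁻ ω, ENNReal.ofReal (f ω) ∂P ≤ ENNReal.ofReal c) :
    Integrable f P ∧ ∫ ω, f ω ∂P ≤ c := by
  refine ⟨⟨hf.aestronglyMeasurable, ?_⟩, ?_⟩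
  · rw [hasFiniteIntegral_iff_ofReal (ae_of_all _ h0)]
    exact h.trans_lt ENNReal.ofReal_lt_top
  · rw [integral_eq_lintegral_of_nonneg_ae (ae_of_all _ h0) hf.aestronglyMeasurable]
    exact ENNReal.toReal_le_of_le_ofReal hc h

theorem measurable_frame_fst (n : Fin N) (k : ℕ) : Measurable fun ω => ((X.frame n k ω).1 : ℝ) :=
  measurable_from_top.comp (measurable_frame_duration.comp (X.measurable_frame n k))

/-- Frame durations have second moment at most `B`. -/
theorem integrable_duration_sq [IsProbabilityMeasure P] (hS : S.Bounded ymax zmax dmax B)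
    (n : Fin N) (k : ℕ) : Integrable (fun ω => ((X.frame n k ω).1 : ℝ) ^ 2) P ∧
      ∫ ω, ((X.frame n k ω).1 : ℝ) ^ 2 ∂P ≤ B := by
  have h := X.setLIntegral_residual_le hS n k 0 (A := Set.univ) MeasurableSet.univ
  refine integrable_of_lintegral_ofReal_le ((X.measurable_frame_fst n k).pow_const 2)
    (fun ω => sq_nonneg _) (zero_le_one.trans hS.one_le) ?_
  simpa using h

theorem integrable_duration [IsProbabilityMeasure P] (hS : S.Bounded ymax zmax dmax B)
    (n : Fin N) (k : ℕ) : Integrable (fun ω => ((X.frame n k ω).1 : ℝ)) P := by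
  refine ((X.integrable_duration_sq hS n k).1.add (integrable_const 1)).mono'
    (X.measurable_frame_fst n k).aestronglyMeasurable (ae_of_all _ fun ω => ?_)
  rw [Real.norm_eq_abs, abs_of_nonneg (Nat.cast_nonneg _), Pi.add_apply]
  nlinarith [sq_nonneg (((X.frame n k ω).1 : ℝ) - 1)]

/-- The overshoot of the renewals of system `n` over slot `T`. -/
def residual (n : Fin N) (T : ℕ) (ω : Ω) : ℕ := overshoot (fun k => X.time n k ω) T

theorem measurable_residual (n : Fin N) (T : ℕ) : Measurable fun ω => (X.residual n T ω : ℝ) := by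
  refine (measurable_from_top (f := fun n : ℕ => (n : ℝ))).comp ?_
  refine Finset.measurable_sum (Finset.range T)
    (f := fun k ω => if X.time n k ω < T then X.time n (k + 1) ω - T else 0)
    fun k _ => Measurable.ite ?_ ?_ measurable_const
  · exact X.measurable_time n k measurableSet_Iio
  · exact (measurable_from_top (f := fun m : ℕ => m - T)).comp (X.measurable_time n (k + 1))

/-- The overshoot over any slot has second moment at most `B`. -/
theorem integrable_residual_sq [IsProbabilityMeasure P] (hS : S.Bounded ymax zmax dmax B)
    (n : Fin N) (T : ℕ) : Integrable (fun ω => (X.residual n T ω : ℝ) ^ 2) P ∧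
      ∫ ω, (X.residual n T ω : ℝ) ^ 2 ∂P ≤ B := by
  refine integrable_of_lintegral_ofReal_le ((X.measurable_residual n T).pow_const 2)
    (fun ω => sq_nonneg _) (zero_le_one.trans hS.one_le) ?_
  rcases Nat.eq_zero_or_pos T with rfl | hT
  · simp [residual, overshoot]
  -- Frame `k` starts at `j` and reaches `T`. Fixing `j` makes the age at `T` deterministic, so the
  -- residual-life bound applies with `s = T - j`.
  set A : ℕ → ℕ → Set Ω := fun k j => {ω | X.time n k ω = j} ∩ {ω | T - j ≤ (X.frame n k ω).1}
    with hAdef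
  have hA : ∀ k j, MeasurableSet (A k j) := fun k j =>
    (X.info_le n k _ (X.measurableSet_info_time_eq n k j)).inter
      (X.measurable_frame n k (measurable_frame_duration measurableSet_Ici))
  set g : ℕ → ℕ → Ω → ℝ≥0∞ := fun k j ω =>
    ENNReal.ofReal (((X.frame n k ω).1 - (T - j : ℕ) : ℝ) ^ 2) with hg
  have hgm : ∀ k j, Measurable (g k j) := fun k j => by
    have := X.measurable_frame_fst n k
    simp only [hg]
    fun_prop
  have hmem : ∀ ω k j, j < T → (ω ∈ A k j ↔ X.time n k ω = j ∧ X.time n k ω < T ∧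
      T ≤ X.time n (k + 1) ω) := by
    intro ω k j hj
    have := X.time_lt n k ω
    simp only [hAdef, Set.mem_inter_iff, Set.mem_ofPred_eq, frame]
    omega
  calc ∫⁻ ω, ENNReal.ofReal ((X.residual n T ω : ℝ) ^ 2) ∂P
      ≤ ∫⁻ ω, ∑ k ∈ Finset.range T, ∑ j ∈ Finset.range T, (A k j).indicator (g k j) ω ∂P := by
        refine lintegral_mono fun ω => ?_
        obtain ⟨J, hJ, h1, h2, h3, -⟩ :=
          exists_straddling (X.time_zero n ω) (X.strictMono_time n ω) hT
        have h4 : ω ∈ A J (X.time n J ω) := (hmem ω J _ h1).2 ⟨rfl, h1, h2⟩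
        refine le_trans (le_of_eq ?_) ((Finset.single_le_sum
          (f := fun j => (A J j).indicator (g J j) ω) (fun _ _ => zero_le)
          (Finset.mem_range.2 h1)).trans (Finset.single_le_sum
          (f := fun k => ∑ j ∈ Finset.range T, (A k j).indicator (g k j) ω) (fun _ _ => zero_le)
          (Finset.mem_range.2 hJ)))
        simp only [Set.indicator_of_mem h4, hg]
        congr 2
        have h5 : X.residual n T ω = (X.frame n J ω).1 - (T - X.time n J ω) := by
          simp only [residual, frame]
          omega
        rw [h5, Nat.cast_sub h4.2]
    _ = ∑ k ∈ Finset.range T, ∑ j ∈ Finset.range T, ∫⁻ ω in A k j, g k j ω ∂P := by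
        rw [lintegral_finsetSum _ fun k _ =>
          Finset.measurable_sum _ fun j _ => (hgm k j).indicator (hA k j)]
        refine Finset.sum_congr rfl fun k _ => ?_
        rw [lintegral_finsetSum _ fun j _ => (hgm k j).indicator (hA k j)]
        exact Finset.sum_congr rfl fun j _ => lintegral_indicator (hA k j) _
    _ ≤ ∑ k ∈ Finset.range T, ∑ j ∈ Finset.range T, ENNReal.ofReal B * P (A k j) := by
        refine Finset.sum_le_sum fun k _ => Finset.sum_le_sum fun j _ => ?_
        exact X.setLIntegral_residual_le hS n k (T - j) (X.measurableSet_info_time_eq n k j)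
    _ = ENNReal.ofReal B * ∫⁻ ω, ∑ k ∈ Finset.range T, ∑ j ∈ Finset.range T,
          (A k j).indicator (fun _ => 1) ω ∂P := by
        rw [lintegral_finsetSum _ fun k _ =>
          Finset.measurable_sum _ fun j _ => measurable_const.indicator (hA k j), Finset.mul_sum]
        refine Finset.sum_congr rfl fun k _ => ?_
        rw [lintegral_finsetSum _ fun j _ => measurable_const.indicator (hA k j), Finset.mul_sum]
        refine Finset.sum_congr rfl fun j _ => ?_
        rw [lintegral_indicator (hA k j), setLIntegral_one]
    -- The events `A k j` with `k, j < T` are disjoint, since only one frame straddles `T`; their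
    -- probabilities sum to at most one.
    _ ≤ ENNReal.ofReal B * ∫⁻ _, 1 ∂P := by
        gcongr with ω
        obtain ⟨J, hJ, h1, h2, -, h3⟩ :=
          exists_straddling (X.time_zero n ω) (X.strictMono_time n ω) hT
        rw [Finset.sum_eq_single J, Finset.sum_eq_single (X.time n J ω)]
        · exact Set.indicator_le_self' (fun _ _ => zero_le) ω
        · intro j hj hne
          refine Set.indicator_of_notMem (fun h => ?_) _
          exact hne ((hmem ω J j (Finset.mem_range.1 hj)).1 h).1.symm
        · exact fun h => absurd (Finset.mem_range.2 h1) h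
        · intro k _ hk
          refine Finset.sum_eq_zero fun j hj => Set.indicator_of_notMem (fun h => ?_) _
          exact h3 k hk ((hmem ω k j (Finset.mem_range.1 hj)).1 h).2
        · exact fun h => absurd (Finset.mem_range.2 hJ) h
    _ = ENNReal.ofReal B := by simp

theorem integrable_residual [IsProbabilityMeasure P] (hS : S.Bounded ymax zmax dmax B)
    (n : Fin N) (T : ℕ) : Integrable (fun ω => (X.residual n T ω : ℝ)) P ∧
      ∫ ω, (X.residual n T ω : ℝ) ∂P ≤ B := by
  have h := X.integrable_residual_sq hS n T
  have hle : ∀ ω, (X.residual n T ω : ℝ) ≤ (X.residual n T ω : ℝ) ^ 2 := fun ω => by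
    exact_mod_cast Nat.le_self_pow two_ne_zero _
  have h1 : Integrable (fun ω => (X.residual n T ω : ℝ)) P :=
    h.1.mono' (X.measurable_residual n T).aestronglyMeasurable (ae_of_all _ fun ω => by
      rw [Real.norm_eq_abs, abs_of_nonneg (Nat.cast_nonneg _)]
      exact hle ω)
  exact ⟨h1, (integral_mono h1 h.1 hle).trans h.2⟩

end Realization

/-! ### Frame totals and bounds in each slot -/

/-- Total penalty of a frame. -/
def framePenalty {L : ℕ} (F : Frame L) : ℝ := ∑ i, (F.2 i).1

/-- Total of metric `l` over a frame. -/
def frameMetric {L : ℕ} (l : Fin L) (F : Frame L) : ℝ := ∑ i, (F.2 i).2 l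

theorem measurable_framePenalty {L : ℕ} : Measurable (framePenalty (L := L)) :=
  measurable_frame_sum measurable_fst

theorem measurable_frameMetric {L : ℕ} (l : Fin L) : Measurable (frameMetric l) :=
  measurable_frame_sum (φ := fun x => x.2 l) ((measurable_pi_apply l).comp measurable_snd)

theorem measurable_frameDuration {L : ℕ} : Measurable fun F : Frame L => (F.1 : ℝ) :=
  measurable_from_top.comp measurable_frame_duration

theorem abs_framePenalty_le {L : ℕ} {F : Frame L} {c : ℝ} (h : ∀ i, |(F.2 i).1| ≤ c) :
    |framePenalty F| ≤ c * F.1 := by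
  refine (Finset.abs_sum_le_sum_abs _ _).trans ((Finset.sum_le_sum fun i _ => h i).trans ?_)
  simp [mul_comm]

theorem abs_frameMetric_le {L : ℕ} {F : Frame L} {l : Fin L} {c : ℝ}
    (h : ∀ i, |(F.2 i).2 l| ≤ c) : |frameMetric l F| ≤ c * F.1 := by
  refine (Finset.abs_sum_le_sum_abs _ _).trans ((Finset.sum_le_sum fun i _ => h i).trans ?_)
  simp [mul_comm]

namespace Systems.Bounded

variable {N L : ℕ} {S : Systems.{u} N L} {ymax zmax dmax B : ℝ}

theorem integrable_duration_law (hS : S.Bounded ymax zmax dmax B) (n : Fin N) (a : S.Action n) :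
    Integrable (fun F : Frame L => (F.1 : ℝ)) (S.frameLaw n a) := by
  have h := hS.setLIntegral_residual_le n a 0
  have h2 : Integrable (fun F : Frame L => (F.1 : ℝ) ^ 2) (S.frameLaw n a) := by
    refine ⟨(measurable_frameDuration.pow_const 2).aestronglyMeasurable, ?_⟩
    rw [hasFiniteIntegral_iff_ofReal (ae_of_all _ fun _ => sq_nonneg _)]
    refine lt_of_le_of_lt ?_ (ENNReal.ofReal_lt_top (r := B))
    simpa using h
  refine (h2.add (integrable_const 1)).mono'
    measurable_frameDuration.aestronglyMeasurable (ae_of_all _ fun F => ?_)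
  rw [Real.norm_eq_abs, abs_of_nonneg (Nat.cast_nonneg _), Pi.add_apply]
  nlinarith [sq_nonneg ((F.1 : ℝ) - 1)]

theorem meanDuration_pos (hS : S.Bounded ymax zmax dmax B) (n : Fin N) (a : S.Action n) :
    0 < S.meanDuration n a := by
  have h : ∫ _, (1 : ℝ) ∂(S.frameLaw n a) ≤ S.meanDuration n a := by
    refine integral_mono_ae (integrable_const 1) (hS.integrable_duration_law n a) ?_
    filter_upwards [S.duration_pos n a] with F hF
    exact_mod_cast hF
  simp only [integral_const, probReal_univ, smul_eq_mul, mul_one] at h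
  linarith

end Systems.Bounded

theorem integral_add_sum_sub {Ω ι : Type*} [MeasurableSpace Ω] [Fintype ι] {P : Measure Ω}
    {U m : Ω → ℝ} {W : ι → Ω → ℝ} (hU : Integrable U P) (hW : ∀ l, Integrable (W l) P)
    (hm : Integrable m P) : Integrable (fun ω => U ω + ∑ l, W l ω - m ω) P ∧
      ∫ ω, (U ω + ∑ l, W l ω - m ω) ∂P = ∫ ω, U ω ∂P + ∑ l, ∫ ω, W l ω ∂P - ∫ ω, m ω ∂P := by
  have hs : Integrable (fun ω => ∑ l, W l ω) P := integrable_finsetSum _ fun l _ => hW l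
  have hUs : Integrable (fun ω => U ω + ∑ l, W l ω) P := hU.add hs
  exact ⟨hUs.sub hm, by
    rw [integral_sub hUs hm, integral_add hU hs, integral_finsetSum _ fun l _ => hW l]⟩

namespace Realization

variable {N L : ℕ} {S : Systems.{u} N L} {Ω : Type v} [mΩ : MeasurableSpace Ω] {P : Measure Ω}
  (X : Realization S P) {ymax zmax dmax B : ℝ}

/-- In the realization of the process at `ω`, the bounds hold in each slot. -/
def BoundedAt (ymax zmax dmax : ℝ) (ω : Ω) : Prop :=
  ∀ t, (∀ n, |X.penalty n t ω| ≤ ymax) ∧ (∀ n l, |X.metric n t ω l| ≤ zmax) ∧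
    ∀ l, |X.ext t ω l| ≤ dmax

/-- The bounds are assumed for frame laws; they pass to slots because every slot lies in some frame.
-/
theorem ae_boundedAt (hS : S.Bounded ymax zmax dmax B) :
    ∀ᵐ ω ∂P, X.BoundedAt ymax zmax dmax ω := by
  have h1 : ∀ᵐ ω ∂P, ∀ n k, X.frame n k ω ∈ {F : Frame L | ∀ i, F.2 i ∈ {x | |x.1| ≤ ymax}} := by
    refine ae_all_iff.2 fun n => ae_all_iff.2 fun k => X.ae_frame n k
      (measurableSet_frame_forall ?_) (hS.penalty_le n)
    exact measurableSet_le (by fun_prop) measurable_const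
  have h2 : ∀ᵐ ω ∂P, ∀ n k,
      X.frame n k ω ∈ {F : Frame L | ∀ i, F.2 i ∈ {x | ∀ l, |x.2 l| ≤ zmax}} := by
    refine ae_all_iff.2 fun n => ae_all_iff.2 fun k => X.ae_frame n k
      (measurableSet_frame_forall ?_) (hS.metric_le n)
    rw [Set.ofPred_forall]
    exact MeasurableSet.iInter fun l => measurableSet_le (by fun_prop) measurable_const
  have h3 : ∀ᵐ ω ∂P, ∀ t, ∀ l, |X.ext t ω l| ≤ dmax := by
    refine ae_all_iff.2 fun t => ?_
    have := hS.ext_le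
    rw [← X.ext_law t] at this
    exact ae_of_ae_map (X.measurable_ext t).aemeasurable this
  filter_upwards [h1, h2, h3] with ω h1 h2 h3 t
  refine ⟨fun n => ?_, fun n => ?_, h3 t⟩
  · obtain ⟨k, i, hi, rfl⟩ := exists_frame_slot (X.time_zero n ω) (X.strictMono_time n ω) t
    exact h1 n k ⟨i, hi⟩
  · obtain ⟨k, i, hi, rfl⟩ := exists_frame_slot (X.time_zero n ω) (X.strictMono_time n ω) t
    exact h2 n k ⟨i, hi⟩

theorem integrable_penalty [IsProbabilityMeasure P] (hS : S.Bounded ymax zmax dmax B) (n : Fin N)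
    (t : ℕ) : Integrable (X.penalty n t) P := by
  refine (integrable_const ymax).mono' (X.measurable_penalty n t).aestronglyMeasurable ?_
  filter_upwards [X.ae_boundedAt hS] with ω hω using (hω t).1 n

theorem integrable_metric [IsProbabilityMeasure P] (hS : S.Bounded ymax zmax dmax B) (n : Fin N)
    (t : ℕ) (l : Fin L) : Integrable (fun ω => X.metric n t ω l) P := by
  refine (integrable_const zmax).mono'
    ((measurable_pi_apply l).comp (X.measurable_metric n t)).aestronglyMeasurable ?_
  filter_upwards [X.ae_boundedAt hS] with ω hω using (hω t).2.1 n l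

theorem integrable_ext [IsProbabilityMeasure P] (hS : S.Bounded ymax zmax dmax B)
    (t : ℕ) (l : Fin L) : Integrable (fun ω => X.ext t ω l) P := by
  refine (integrable_const dmax).mono'
    ((measurable_pi_apply l).comp (X.measurable_ext t)).aestronglyMeasurable ?_
  filter_upwards [X.ae_boundedAt hS] with ω hω using (hω t).2.2 l

theorem framePenalty_frame (n : Fin N) (k : ℕ) (ω : Ω) : framePenalty (X.frame n k ω)
    = ∑ i ∈ Finset.range (X.frame n k ω).1, X.penalty n (X.time n k ω + i) ω :=
  Fin.sum_univ_eq_sum_range (fun i => X.penalty n (X.time n k ω + i) ω) _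

theorem frameMetric_frame (n : Fin N) (k : ℕ) (l : Fin L) (ω : Ω) :
    frameMetric l (X.frame n k ω)
      = ∑ i ∈ Finset.range (X.frame n k ω).1, X.metric n (X.time n k ω + i) ω l :=
  Fin.sum_univ_eq_sum_range (fun i => X.metric n (X.time n k ω + i) ω l) _

theorem integrable_framePenalty [IsProbabilityMeasure P] (hS : S.Bounded ymax zmax dmax B)
    (n : Fin N) (k : ℕ) : Integrable (fun ω => framePenalty (X.frame n k ω)) P := by
  refine ((X.integrable_duration hS n k).const_mul ymax).mono'
    (measurable_framePenalty.comp (X.measurable_frame n k)).aestronglyMeasurable ?_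
  filter_upwards [X.ae_boundedAt hS] with ω hω
  exact abs_framePenalty_le fun i => (hω _).1 n

theorem integrable_frameMetric [IsProbabilityMeasure P] (hS : S.Bounded ymax zmax dmax B)
    (n : Fin N) (k : ℕ) (l : Fin L) : Integrable (fun ω => frameMetric l (X.frame n k ω)) P := by
  refine ((X.integrable_duration hS n k).const_mul zmax).mono'
    ((measurable_frameMetric l).comp (X.measurable_frame n k)).aestronglyMeasurable ?_
  filter_upwards [X.ae_boundedAt hS] with ω hω
  exact abs_frameMetric_le fun i => (hω _).2.1 n l

/-! ### Linear functionals of the performance -/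

theorem measurable_started_info (n : Fin N) (k T : ℕ) :
    Measurable[X.info n k] fun ω => if X.time n k ω < T then (1 : ℝ) else 0 :=
  (measurable_from_top (f := fun j : ℕ => if j < T then (1 : ℝ) else 0)).comp
    (X.measurable_time_info n k)

/-- If a combination of the expected totals of a frame, with bounded weights known at its start, is
nonnegative, then so is the mean of the same combination of the totals of the frame. -/
theorem integral_frame_combination_nonneg [IsProbabilityMeasure P]
    (hS : S.Bounded ymax zmax dmax B) (n : Fin N) (k : ℕ) {U m : Ω → ℝ} {W : Fin L → Ω → ℝ}
    (hU : Measurable[X.info n k] U) (hm : Measurable[X.info n k] m)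
    (hW : ∀ l, Measurable[X.info n k] (W l)) (hUc : ∃ c, ∀ᵐ ω ∂P, |U ω| ≤ c)
    (hmc : ∃ c, ∀ᵐ ω ∂P, |m ω| ≤ c) (hWc : ∀ l, ∃ c, ∀ᵐ ω ∂P, |W l ω| ≤ c)
    (h : ∀ᵐ ω ∂P, 0 ≤ U ω * S.meanPenalty n (X.action n k ω)
      + ∑ l, W l ω * S.meanMetric n (X.action n k ω) l - m ω * S.meanDuration n (X.action n k ω)) :
    Integrable (fun ω => U ω * framePenalty (X.frame n k ω)
      + ∑ l, W l ω * frameMetric l (X.frame n k ω) - m ω * ((X.frame n k ω).1 : ℝ)) P ∧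
    0 ≤ ∫ ω, (U ω * framePenalty (X.frame n k ω)
      + ∑ l, W l ω * frameMetric l (X.frame n k ω) - m ω * ((X.frame n k ω).1 : ℝ)) ∂P := by
  obtain ⟨cU, hUc⟩ := hUc
  obtain ⟨cm, hmc⟩ := hmc
  choose cW hWc using hWc
  obtain ⟨i1, j1, e1⟩ := X.integral_mul_frame n k measurable_framePenalty
    (X.integrable_framePenalty hS n k) hU cU hUc
  obtain ⟨i2, j2, e2⟩ := X.integral_mul_frame n k measurable_frameDuration
    (X.integrable_duration hS n k) hm cm hmc
  have h3 := fun l => X.integral_mul_frame n k (measurable_frameMetric l)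
    (X.integrable_frameMetric hS n k l) (hW l) (cW l) (hWc l)
  obtain ⟨i, e⟩ := integral_add_sum_sub i1 (fun l => (h3 l).1) i2
  refine ⟨i, ?_⟩
  rw [e, e1, e2, Finset.sum_congr rfl fun l _ => (h3 l).2.2,
    ← (integral_add_sum_sub j1 (fun l => (h3 l).2.1) j2).2]
  exact integral_nonneg_of_ae h

/-- Partial sums of a linear functional of the performance that is nonnegative on the mean of
each frame are bounded below. -/
theorem sum_linear_ge [IsProbabilityMeasure P] (hS : S.Bounded ymax zmax dmax B) (n : Fin N)
    (c m : ℝ) (w : Fin L → ℝ) (h : ∀ a, 0 ≤ c * S.meanPenalty n a + ∑ l, w l * S.meanMetric n a l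
      - m * S.meanDuration n a) (T : ℕ) :
    -((|c| * ymax + ∑ l, |w l| * zmax + |m|) * B) ≤ ∑ t ∈ Finset.range T,
      (c * ∫ ω, X.penalty n t ω ∂P + ∑ l, w l * ∫ ω, X.metric n t ω l ∂P - m) := by
  set f : ℕ → Ω → ℝ := fun t ω => c * X.penalty n t ω + ∑ l, w l * X.metric n t ω l - m with hf
  set K := |c| * ymax + ∑ l, |w l| * zmax + |m| with hK
  set G : ℕ → Ω → ℝ := fun k ω => (if X.time n k ω < T then 1 else 0) * c
      * framePenalty (X.frame n k ω) + ∑ l, ((if X.time n k ω < T then 1 else 0) * w l)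
      * frameMetric l (X.frame n k ω) - ((if X.time n k ω < T then 1 else 0) * m)
      * ((X.frame n k ω).1 : ℝ) with hG
  have hf' := fun t => integral_add_sum_sub ((X.integrable_penalty hS n t).const_mul c)
    (fun l => (X.integrable_metric hS n t l).const_mul (w l)) (integrable_const m)
  have hfint : ∀ t, Integrable (f t) P := fun t => (hf' t).1
  have hfint_eq : ∀ t, ∫ ω, f t ω ∂P
      = c * ∫ ω, X.penalty n t ω ∂P + ∑ l, w l * ∫ ω, X.metric n t ω l ∂P - m := by
    intro t
    simpa only [integral_const_mul, integral_const, probReal_univ, one_smul] using (hf' t).2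
  have hGk : ∀ k, Integrable (G k) P ∧ 0 ≤ ∫ ω, G k ω ∂P := by
    intro k
    have hI := X.measurable_started_info n k T
    have hb : ∀ x : ℝ, ∃ b, ∀ᵐ ω ∂P, |(if X.time n k ω < T then (1 : ℝ) else 0) * x| ≤ b := by
      refine fun x => ⟨|x|, ae_of_all _ fun ω => ?_⟩
      split_ifs <;> simp
    refine X.integral_frame_combination_nonneg hS n k (hI.mul_const c) (hI.mul_const m)
      (fun l => hI.mul_const (w l)) (hb _) (hb _) (fun l => hb _) (ae_of_all _ fun ω => ?_)
    have := h (X.action n k ω)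
    split_ifs
    · simpa using this
    · simp
  -- The started frames cover the slots before `T` and the overshoot, each of whose slots
  -- contributes at most `K`.
  have hpath : ∀ᵐ ω ∂P, ∑ k ∈ Finset.range T, G k ω - K * (X.residual n T ω : ℝ)
      ≤ ∑ t ∈ Finset.range T, f t ω := by
    filter_upwards [X.ae_boundedAt hS] with ω hω
    have h1 := sum_started_frames (X.time_zero n ω) (X.strictMono_time n ω) (fun t => f t ω) T
    have h2 : ∀ k, (if X.time n k ω < T then
        ∑ i ∈ Finset.range (X.time n (k + 1) ω - X.time n k ω), f (X.time n k ω + i) ω else 0)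
        = G k ω := by
      intro k
      simp only [hG, framePenalty_frame, frameMetric_frame]
      split_ifs
      · simp only [hf, Finset.sum_sub_distrib, Finset.sum_add_distrib, one_mul, frame]
        rw [Finset.sum_comm]
        simp [Finset.mul_sum, mul_comm]
      · simp
    simp only [h2] at h1
    have h3 : ∀ t, f t ω ≤ K := by
      intro t
      obtain ⟨hy, hz, -⟩ := hω t
      have e1 : c * X.penalty n t ω ≤ |c| * ymax :=
        (le_abs_self _).trans (by rw [abs_mul]; gcongr; exact hy n)
      have e2 : ∑ l, w l * X.metric n t ω l ≤ ∑ l, |w l| * zmax := Finset.sum_le_sum fun l _ =>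
        (le_abs_self _).trans (by rw [abs_mul]; gcongr; exact hz n l)
      simp only [hf, hK]
      linarith [neg_abs_le m]
    have h4 : ∑ i ∈ Finset.range (overshoot (fun k => X.time n k ω) T), f (T + i) ω
        ≤ K * (X.residual n T ω : ℝ) := by
      refine (Finset.sum_le_sum fun i _ => h3 (T + i)).trans ?_
      simp [residual, mul_comm]
    linarith
  have hres := X.integrable_residual hS n T
  have hGint := integrable_finsetSum (Finset.range T) fun k _ => (hGk k).1
  have hmono := integral_mono_ae (hGint.sub (hres.1.const_mul K))
    (integrable_finsetSum (Finset.range T) fun t _ => hfint t) hpath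
  simp only [Pi.sub_apply] at hmono
  rw [integral_sub hGint (hres.1.const_mul K), integral_const_mul,
    integral_finsetSum _ fun k _ => (hGk k).1, integral_finsetSum _ fun t _ => hfint t,
    Finset.sum_congr rfl fun t _ => hfint_eq t] at hmono
  have hG0 := Finset.sum_nonneg fun k (_ : k ∈ Finset.range T) => (hGk k).2
  obtain ⟨ω, hω⟩ := (X.ae_boundedAt hS).exists
  have hK0 : 0 ≤ K := by
    have e1 : 0 ≤ ymax := (abs_nonneg _).trans ((hω 0).1 n)
    have e2 : ∀ l : Fin L, 0 ≤ |w l| * zmax := fun l =>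
      mul_nonneg (abs_nonneg _) ((abs_nonneg _).trans ((hω 0).2.1 n l))
    have e3 := Finset.sum_nonneg fun l (_ : l ∈ Finset.univ) => e2 l
    have e4 := mul_nonneg (abs_nonneg c) e1
    linarith [abs_nonneg m]
  have := mul_le_mul_of_nonneg_left hres.2 hK0
  linarith

end Realization

/-! ### Limits of time averages -/

theorem abs_average_le {a : ℕ → ℝ} {c : ℝ} (hc : 0 ≤ c) (h : ∀ t, |a t| ≤ c) (T : ℕ) :
    |1 / (T : ℝ) * ∑ t ∈ Finset.range T, a t| ≤ c := by
  rcases Nat.eq_zero_or_pos T with rfl | hT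
  · simpa using hc
  · have hT' : (0 : ℝ) < T := Nat.cast_pos.2 hT
    rw [abs_mul, abs_of_pos (one_div_pos.2 hT'), one_div, inv_mul_le_iff₀ hT']
    refine (Finset.abs_sum_le_sum_abs _ _).trans ((Finset.sum_le_sum fun t _ => h t).trans ?_)
    simp

/-- The limit of a sequence of reals along a subsequence is at most its upper limit. -/
theorem coe_le_limsup_of_tendsto_subseq {a : ℕ → ℝ} {φ : ℕ → ℕ} (hφ : StrictMono φ) {x : ℝ}
    (h : Tendsto (fun i => a (φ i)) atTop (𝓝 x)) :
    (x : EReal) ≤ limsup (fun T => (a T : EReal)) atTop := by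
  have h1 : Tendsto (fun i => (a (φ i) : EReal)) atTop (𝓝 (x : EReal)) :=
    (continuous_coe_real_ereal.tendsto x).comp h
  rw [← h1.limsup_eq]
  exact limsup_le_limsup_of_le (f := map φ atTop) (u := fun T => (a T : EReal)) hφ.tendsto_atTop

namespace Realization

variable {N L : ℕ} {S : Systems.{u} N L} {Ω : Type v} [mΩ : MeasurableSpace Ω] {P : Measure Ω}
  (X : Realization S P) {ymax zmax dmax B : ℝ}

theorem abs_integral_penalty_le [IsProbabilityMeasure P] (hS : S.Bounded ymax zmax dmax B)
    (n : Fin N) (t : ℕ) : |∫ ω, X.penalty n t ω ∂P| ≤ ymax := by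
  have := norm_integral_le_of_norm_le_const (μ := P) (f := X.penalty n t) (C := ymax)
    ((X.ae_boundedAt hS).mono fun ω hω => (hω t).1 n)
  simpa using this

theorem abs_integral_metric_le [IsProbabilityMeasure P] (hS : S.Bounded ymax zmax dmax B)
    (n : Fin N) (l : Fin L) (t : ℕ) : |∫ ω, X.metric n t ω l ∂P| ≤ zmax := by
  have := norm_integral_le_of_norm_le_const (μ := P) (f := fun ω => X.metric n t ω l) (C := zmax)
    ((X.ae_boundedAt hS).mono fun ω hω => (hω t).2.1 n l)
  simpa using this

/-- Every realization has a vector of limit performances of the individual systems which is not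
worse than its time averages, and on which each linear functional is at least its infimum over the
performance vectors of the actions. -/
theorem exists_limit_performance [IsProbabilityMeasure P] (hS : S.Bounded ymax zmax dmax B) :
    ∃ (f : Fin N → ℝ) (g : Fin N → Fin L → ℝ),
      ((∑ n, f n : ℝ) : EReal) ≤ X.avgPenalty ∧
      (∀ l, ((∑ n, g n l : ℝ) : EReal) ≤ X.avgMetric l) ∧
      (∀ n, |f n| ≤ ymax) ∧ (∀ n l, |g n l| ≤ zmax) ∧
      ∀ (n : Fin N) (c m : ℝ) (w : Fin L → ℝ),
        (∀ a, 0 ≤ c * S.meanPenalty n a + ∑ l, w l * S.meanMetric n a l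
          - m * S.meanDuration n a) → m ≤ c * f n + ∑ l, w l * g n l := by
  set y : ℕ → Fin N → ℝ := fun T n =>
    1 / (T : ℝ) * ∑ t ∈ Finset.range T, ∫ ω, X.penalty n t ω ∂P with hy
  set z : ℕ → Fin N → Fin L → ℝ := fun T n l =>
    1 / (T : ℝ) * ∑ t ∈ Finset.range T, ∫ ω, X.metric n t ω l ∂P with hz
  have hyb : ∀ T n, |y T n| ≤ ymax := fun T n =>
    abs_average_le ((abs_nonneg _).trans (X.abs_integral_penalty_le hS n 0)) (X.abs_integral_penalty_le hS n) T
  have hzb : ∀ T n l, |z T n l| ≤ zmax := fun T n l =>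
    abs_average_le ((abs_nonneg _).trans (X.abs_integral_metric_le hS n l 0)) (X.abs_integral_metric_le hS n l) T
  have hmem : ∀ T, (y T, z T) ∈ Metric.closedBall (0 : (Fin N → ℝ) × (Fin N → Fin L → ℝ))
      (|ymax| + |zmax|) := by
    intro T
    rw [mem_closedBall_zero_iff, Prod.norm_def]
    have h0 : 0 ≤ |ymax| + |zmax| := by positivity
    refine max_le ((pi_norm_le_iff_of_nonneg h0).2 fun n => ?_)
      ((pi_norm_le_iff_of_nonneg h0).2 fun n => (pi_norm_le_iff_of_nonneg h0).2 fun l => ?_)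
    · exact (hyb T n).trans ((le_abs_self _).trans (by linarith [abs_nonneg zmax]))
    · exact (hzb T n l).trans ((le_abs_self _).trans (by linarith [abs_nonneg ymax]))
  -- One subsequence serves all coordinates, so that linear combinations of penalties and metrics
  -- converge along it too.
  obtain ⟨⟨f, g⟩, -, φ, hφ, hlim⟩ :=
    tendsto_subseq_of_bounded Metric.isBounded_closedBall hmem
  have hyf : ∀ n, Tendsto (fun i => y (φ i) n) atTop (𝓝 (f n)) := fun n =>
    tendsto_pi_nhds.1 ((continuous_fst.tendsto _).comp hlim) n
  have hzg : ∀ n l, Tendsto (fun i => z (φ i) n l) atTop (𝓝 (g n l)) := fun n l =>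
    tendsto_pi_nhds.1 (tendsto_pi_nhds.1 ((continuous_snd.tendsto _).comp hlim) n) l
  refine ⟨f, g, ?_, fun l => ?_, fun n => ?_, fun n l => ?_, fun n c m w h => ?_⟩
  · refine coe_le_limsup_of_tendsto_subseq hφ ?_
    refine (tendsto_finsetSum Finset.univ fun n _ => hyf n).congr fun i => ?_
    rw [Finset.sum_comm, Finset.mul_sum]
  · refine coe_le_limsup_of_tendsto_subseq hφ ?_
    refine (tendsto_finsetSum Finset.univ fun n _ => hzg n l).congr fun i => ?_
    rw [Finset.sum_comm, Finset.mul_sum]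
  · exact le_of_tendsto (hyf n).abs (Eventually.of_forall fun i => hyb _ n)
  · exact le_of_tendsto (hzg n l).abs (Eventually.of_forall fun i => hzb _ n l)
  · have h1 : Tendsto (fun i => c * y (φ i) n + ∑ l, w l * z (φ i) n l) atTop
        (𝓝 (c * f n + ∑ l, w l * g n l)) :=
      ((hyf n).const_mul c).add (tendsto_finsetSum _ fun l _ => (hzg n l).const_mul (w l))
    set K := (|c| * ymax + ∑ l, |w l| * zmax + |m|) * B
    have h2 : Tendsto (fun i => m - K / (φ i : ℝ)) atTop (𝓝 (m - 0)) :=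
      tendsto_const_nhds.sub ((tendsto_const_div_atTop_nhds_zero_nat K).comp hφ.tendsto_atTop)
    rw [sub_zero] at h2
    refine le_of_tendsto_of_tendsto h2 h1 ?_
    filter_upwards [hφ.tendsto_atTop.eventually_gt_atTop 0] with i hi
    have hT : (0 : ℝ) < φ i := Nat.cast_pos.2 hi
    have h3 := X.sum_linear_ge hS n c m w h (φ i)
    rw [Finset.sum_sub_distrib, Finset.sum_add_distrib, Finset.sum_comm] at h3
    simp only [← Finset.mul_sum, Finset.sum_const, Finset.card_range, nsmul_eq_mul] at h3
    have h4 : c * y (φ i) n + ∑ l, w l * z (φ i) n l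
        = (c * ∑ t ∈ Finset.range (φ i), ∫ ω, X.penalty n t ω ∂P
          + ∑ l, w l * ∑ t ∈ Finset.range (φ i), ∫ ω, X.metric n t ω l ∂P) / (φ i : ℝ) := by
      simp only [hy, hz, add_div, Finset.sum_div]
      congr 1
      · ring
      · exact Finset.sum_congr rfl fun l _ => by ring
    rw [h4, le_div_iff₀ hT, sub_mul, div_mul_cancel₀ _ hT.ne']
    linarith

end Realization

/-! ### Virtual queues and their quadratic drift -/

namespace Realization

variable {N L : ℕ} {S : Systems.{u} N L} {Ω : Type v} [mΩ : MeasurableSpace Ω] {P : Measure Ω}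
  (X : Realization S P) {ymax zmax dmax B : ℝ}

theorem measurable_queue_history (t : ℕ) (l : Fin L) :
    Measurable[X.history t] fun ω => X.queue t ω l := by
  induction t with
  | zero => exact measurable_const
  | succ t ih =>
    have h1 : Measurable[X.history (t + 1)] fun ω => X.queue t ω l :=
      ih.mono (X.history.mono (Nat.le_succ t)) le_rfl
    have h2 : ∀ n, Measurable[X.history (t + 1)] fun ω => X.metric n t ω l := fun n =>
      (measurable_pi_apply l).comp (X.metric_history n t)
    have h3 : Measurable[X.history (t + 1)] fun ω => X.ext t ω l :=
      (measurable_pi_apply l).comp (X.ext_history t)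
    have h4 : Measurable[X.history (t + 1)] fun ω => ∑ n, X.metric n t ω l :=
      Finset.measurable_sum Finset.univ fun n _ => h2 n
    exact ((h1.add h4).sub h3).max measurable_const

theorem measurable_queue (t : ℕ) (l : Fin L) : Measurable fun ω => X.queue t ω l :=
  (X.measurable_queue_history t l).mono (X.history.le t) le_rfl

theorem queue_nonneg (t : ℕ) (ω : Ω) (l : Fin L) : 0 ≤ X.queue t ω l := by
  cases t with
  | zero => exact le_rfl
  | succ t => exact le_max_right _ _

theorem sum_sub_le_queue (T : ℕ) (ω : Ω) (l : Fin L) :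
    ∑ t ∈ Finset.range T, (∑ n, X.metric n t ω l - X.ext t ω l) ≤ X.queue T ω l := by
  induction T with
  | zero => exact le_rfl
  | succ T ih =>
    rw [Finset.sum_range_succ]
    refine le_trans ?_ (le_max_left _ _)
    linarith

variable {X} in
theorem BoundedAt.abs_arrival_le {ω : Ω} (hω : X.BoundedAt ymax zmax dmax ω) (t : ℕ) (l : Fin L) :
    |∑ n, X.metric n t ω l - X.ext t ω l| ≤ N * zmax + dmax := by
  refine (abs_sub _ _).trans (add_le_add ?_ ((hω t).2.2 l))
  refine (Finset.abs_sum_le_sum_abs _ _).trans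
    ((Finset.sum_le_sum fun n _ => (hω t).2.1 n l).trans ?_)
  simp

variable {X} in
-- Truncation at zero is 1-Lipschitz and fixes the nonnegative queue, so one slot moves the queue by
-- at most the net arrival.
theorem BoundedAt.abs_queue_sub_le {ω : Ω} (hω : X.BoundedAt ymax zmax dmax ω) (t i : ℕ)
    (l : Fin L) : |X.queue (t + i) ω l - X.queue t ω l| ≤ i * (N * zmax + dmax) := by
  induction i with
  | zero => simp
  | succ i ih =>
    have h1 := hω.abs_arrival_le (t + i) l
    have h2 : |X.queue (t + (i + 1)) ω l - X.queue (t + i) ω l|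
        ≤ |∑ n, X.metric n (t + i) ω l - X.ext (t + i) ω l| := by
      have h3 := abs_max_sub_max_le_abs
        (X.queue (t + i) ω l + ∑ n, X.metric n (t + i) ω l - X.ext (t + i) ω l)
        (X.queue (t + i) ω l) 0
      rw [max_eq_left (X.queue_nonneg (t + i) ω l)] at h3
      refine h3.trans (le_of_eq ?_)
      congr 1
      ring
    have h4 := abs_sub_le (X.queue (t + (i + 1)) ω l) (X.queue (t + i) ω l) (X.queue t ω l)
    push_cast
    linarith

variable {X} in
theorem BoundedAt.abs_queue_le {ω : Ω} (hω : X.BoundedAt ymax zmax dmax ω) (t : ℕ)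
    (l : Fin L) : |X.queue t ω l| ≤ t * (N * zmax + dmax) := by
  have h := hω.abs_queue_sub_le 0 t l
  rwa [Nat.zero_add, show X.queue 0 ω l = 0 from rfl, sub_zero] at h

variable {X} in
theorem BoundedAt.sum_queue_sub_mul_le {ω : Ω} (hω : X.BoundedAt ymax zmax dmax ω) (t i : ℕ)
    {x : Fin L → ℝ} (hx : ∀ l, |x l| ≤ 2 * zmax) :
    ∑ l, (X.queue (t + i) ω l - X.queue t ω l) * x l
      ≤ zmax * L * (N * zmax + dmax) * (2 * i) := by
  have h : ∀ l ∈ Finset.univ, (X.queue (t + i) ω l - X.queue t ω l) * x l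
      ≤ (i * (N * zmax + dmax)) * (2 * zmax) := fun l _ => by
    refine (le_abs_self _).trans ?_
    rw [abs_mul]
    have h1 := hω.abs_queue_sub_le t i l
    exact mul_le_mul h1 (hx l) (abs_nonneg _) ((abs_nonneg _).trans h1)
  refine (Finset.sum_le_sum h).trans (le_of_eq ?_)
  simp only [Finset.sum_const, Finset.card_univ, Fintype.card_fin, nsmul_eq_mul]
  ring

variable {X} in
theorem BoundedAt.queue_sq_succ_le {ω : Ω} (hω : X.BoundedAt ymax zmax dmax ω) (t : ℕ)
    (l : Fin L) : X.queue (t + 1) ω l ^ 2 / 2 ≤ X.queue t ω l ^ 2 / 2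
      + X.queue t ω l * (∑ n, X.metric n t ω l - X.ext t ω l) + (N * zmax + dmax) ^ 2 / 2 := by
  have h1 := abs_le.1 (hω.abs_arrival_le t l)
  have h2 : (∑ n, X.metric n t ω l - X.ext t ω l) ^ 2 ≤ (N * zmax + dmax) ^ 2 :=
    sq_le_sq' h1.1 h1.2
  have h3 : X.queue (t + 1) ω l ^ 2
      ≤ (X.queue t ω l + ∑ n, X.metric n t ω l - X.ext t ω l) ^ 2 := by
    change max _ (0 : ℝ) ^ 2 ≤ _
    rcases max_cases (X.queue t ω l + ∑ n, X.metric n t ω l - X.ext t ω l) 0 with h | h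
    · rw [h.1]
    · rw [h.1]
      simpa using sq_nonneg _
  nlinarith

/-- Quadratic Lyapunov drift over `T` slots. -/
theorem BoundedAt.queue_sq_le {X : Realization S P} {ω : Ω} (hω : X.BoundedAt ymax zmax dmax ω)
    (T : ℕ) : ∑ l, X.queue T ω l ^ 2 / 2 ≤ (∑ t ∈ Finset.range T, ∑ l,
      X.queue t ω l * (∑ n, X.metric n t ω l - X.ext t ω l))
      + T * ((N * zmax + dmax) ^ 2 * L / 2) := by
  induction T with
  | zero => simp [show ∀ l, X.queue 0 ω l = 0 from fun _ => rfl]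
  | succ T ih =>
    have h := Finset.sum_le_sum fun l (_ : l ∈ Finset.univ) => hω.queue_sq_succ_le T l
    rw [Finset.sum_add_distrib, Finset.sum_add_distrib] at h
    simp only [Finset.sum_const, Finset.card_univ, Fintype.card_fin, nsmul_eq_mul] at h
    rw [Finset.sum_range_succ]
    push_cast
    linarith

theorem integrable_queue [IsProbabilityMeasure P] (hS : S.Bounded ymax zmax dmax B) (t : ℕ)
    (l : Fin L) : Integrable (fun ω => X.queue t ω l) P := by
  refine (integrable_const (t * (N * zmax + dmax))).mono'
    (X.measurable_queue t l).aestronglyMeasurable ?_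
  filter_upwards [X.ae_boundedAt hS] with ω hω using hω.abs_queue_le t l

theorem integrable_queue_mul [IsProbabilityMeasure P] (hS : S.Bounded ymax zmax dmax B) (t : ℕ)
    (l : Fin L) {f : Ω → ℝ} (hf : Integrable f P) :
    Integrable (fun ω => X.queue t ω l * f ω) P :=
  hf.bdd_mul (X.measurable_queue t l).aestronglyMeasurable
    ((X.ae_boundedAt hS).mono fun _ hω => hω.abs_queue_le t l)

theorem integrable_queue_sq [IsProbabilityMeasure P] (hS : S.Bounded ymax zmax dmax B) (t : ℕ)
    (l : Fin L) : Integrable (fun ω => X.queue t ω l ^ 2) P := by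
  simpa only [sq] using X.integrable_queue_mul hS t l (X.integrable_queue hS t l)

theorem integral_ext (t : ℕ) (l : Fin L) : ∫ ω, X.ext t ω l ∂P = S.extMean l := by
  rw [Systems.extMean, ← X.ext_law t, integral_map (X.measurable_ext t).aemeasurable
    (measurable_pi_apply l).aestronglyMeasurable]

/-- The queue at `t` is a function of the slots before `t`, of which `ext t` is independent. -/
theorem integral_queue_mul_ext (t : ℕ) (l : Fin L) :
    ∫ ω, X.queue t ω l * X.ext t ω l ∂P = (∫ ω, X.queue t ω l ∂P) * S.extMean l := by
  have hind : IndepFun (fun ω => X.queue t ω l) (fun ω => X.ext t ω l) P := by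
    refine (IndepFun_iff_Indep _ _ _).2 ?_
    refine indep_of_indep_of_le_left (indep_of_indep_of_le_right (X.ext_indep t).symm ?_) ?_
    · rw [show (fun ω => X.ext t ω l) = (fun x : Fin L → ℝ => x l) ∘ X.ext t from rfl,
        ← MeasurableSpace.comap_comp]
      exact MeasurableSpace.comap_mono (measurable_pi_apply l).comap_le
    · exact (X.measurable_queue_history t l).comap_le
  rw [← X.integral_ext t l]
  exact hind.integral_fun_mul_eq_mul_integral (X.measurable_queue t l).aestronglyMeasurable
    ((measurable_pi_apply l).comp (X.measurable_ext t)).aestronglyMeasurable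

end Realization

/-! ### Drift plus penalty over frames -/

theorem sum_range_two_mul_le_sq (D : ℕ) : ∑ i ∈ Finset.range D, (2 * (i : ℝ)) ≤ (D : ℝ) ^ 2 := by
  induction D with
  | zero => simp
  | succ D ih =>
    rw [Finset.sum_range_succ]
    push_cast
    nlinarith

namespace Realization

variable {N L : ℕ} {S : Systems.{u} N L} {Ω : Type v} [mΩ : MeasurableSpace Ω] {P : Measure Ω}
  (X : Realization S P) {ymax zmax dmax B V : ℝ}

/-- The drift-plus-penalty term of system `n` in slot `t`, relative to a reference performance. -/
def dppTerm (V : ℝ) (f : ℝ) (g : Fin L → ℝ) (n : Fin N) (t : ℕ) (ω : Ω) : ℝ :=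
  V * (X.penalty n t ω - f) + ∑ l, X.queue t ω l * (X.metric n t ω l - g l)

/-- The drift-plus-penalty total of the `k`-th frame of system `n` with the queues frozen at its
start, relative to a reference performance, if the frame starts before slot `T`. -/
def frozenTotal (V : ℝ) (f : ℝ) (g : Fin L → ℝ) (n : Fin N) (T k : ℕ) (ω : Ω) : ℝ :=
  (if X.time n k ω < T then (1 : ℝ) else 0) * (V * framePenalty (X.frame n k ω)
    + ∑ l, X.queue (X.time n k ω) ω l * frameMetric l (X.frame n k ω)
    - (V * f + ∑ l, X.queue (X.time n k ω) ω l * g l) * ((X.frame n k ω).1 : ℝ))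

theorem integrable_dppTerm [IsProbabilityMeasure P] (hS : S.Bounded ymax zmax dmax B) (f : ℝ)
    (g : Fin L → ℝ) (n : Fin N) (t : ℕ) : Integrable (X.dppTerm V f g n t) P :=
  (((X.integrable_penalty hS n t).sub (integrable_const f)).const_mul V).add
    (integrable_finsetSum _ fun l _ => X.integrable_queue_mul hS t l
      ((X.integrable_metric hS n t l).sub (integrable_const (g l))))

/-- This is where the algorithm enters: the ratio it minimizes, with the queues known at the renewal
as weights, is at most the value of the same functional at the reference. Multiplying by the mean
duration compares frame totals. -/
theorem integral_frozenTotal_nonpos [IsProbabilityMeasure P] (hS : S.Bounded ymax zmax dmax B)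
    (hX : X.FollowsAlgorithm V) {n : Fin N} {f : ℝ} {g : Fin L → ℝ}
    (hfg : ∀ (c m : ℝ) (w : Fin L → ℝ),
      (∀ a, 0 ≤ c * S.meanPenalty n a + ∑ l, w l * S.meanMetric n a l
        - m * S.meanDuration n a) → m ≤ c * f + ∑ l, w l * g l) (T k : ℕ) :
    Integrable (X.frozenTotal V f g n T k) P ∧ ∫ ω, X.frozenTotal V f g n T k ω ∂P ≤ 0 := by
  set I : Ω → ℝ := fun ω => if X.time n k ω < T then (1 : ℝ) else 0 with hIdef
  have hI : Measurable[X.info n k] I := X.measurable_started_info n k T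
  have hq : ∀ l, Measurable[X.info n k] fun ω => X.queue (X.time n k ω) ω l := fun l =>
    X.measurable_info_stopped n k fun t => X.measurable_queue_history t l
  -- The indicator makes the weight bounded: a frame started before `T` sees queues of size at most
  -- `T * |N * zmax + dmax|`.
  have hqb : ∀ l, ∀ᵐ ω ∂P,
      |I ω * X.queue (X.time n k ω) ω l| ≤ T * |(N * zmax + dmax : ℝ)| := by
    intro l
    filter_upwards [X.ae_boundedAt hS] with ω hω
    have h1 := hω.abs_queue_le (X.time n k ω) l
    simp only [hIdef]
    split_ifs with h
    · rw [one_mul]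
      refine h1.trans ((le_abs_self _).trans ?_)
      rw [abs_mul, Nat.abs_cast]
      gcongr
    · rw [zero_mul, abs_zero]
      positivity
  have hqg : Measurable[X.info n k] fun ω => ∑ l, X.queue (X.time n k ω) ω l * g l :=
    Finset.measurable_sum Finset.univ fun l _ => (hq l).mul_const (g l)
  -- All weights are negated, since the lemma transfers nonnegativity and an upper bound is wanted.
  obtain ⟨hint, hnonneg⟩ := X.integral_frame_combination_nonneg hS n k
    (U := fun ω => I ω * -V) (W := fun l ω => -(I ω * X.queue (X.time n k ω) ω l))
    (m := fun ω => -(I ω * (V * f + ∑ l, X.queue (X.time n k ω) ω l * g l)))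
    (hI.mul_const _) (hI.mul (hqg.const_add (V * f))).neg (fun l => (hI.mul (hq l)).neg)
    ⟨|V|, ae_of_all _ fun ω => by simp only [hIdef]; split_ifs <;> simp⟩
    ⟨|V * f| + ∑ l, T * |(N * zmax + dmax : ℝ)| * |g l|, by
      filter_upwards [ae_all_iff.2 hqb] with ω hω
      rw [abs_neg, mul_add, Finset.mul_sum]
      refine (abs_add_le _ _).trans (add_le_add ?_ ?_)
      · simp only [hIdef]
        split_ifs
        · rw [one_mul]
        · simpa using abs_nonneg (V * f)
      · refine (Finset.abs_sum_le_sum_abs _ _).trans (Finset.sum_le_sum fun l _ => ?_)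
        rw [← mul_assoc, abs_mul]
        exact mul_le_mul_of_nonneg_right (hω l) (abs_nonneg _)⟩
    (fun l => ⟨T * |(N * zmax + dmax : ℝ)|, (hqb l).mono fun ω hω => by rwa [abs_neg]⟩)
    (by
      filter_upwards [hX n k] with ω hω
      have hD := hS.meanDuration_pos n (X.action n k ω)
      -- Optimality of the chosen action says that its ratio is an admissible `m` for the weights
      -- `V` and the current queues.
      have h1 := hfg V (S.dppRatio V (X.queue (X.time n k ω) ω) n (X.action n k ω))
        (X.queue (X.time n k ω) ω) fun a => by
          have h2 := hω a
          conv_rhs at h2 => rw [Systems.dppRatio]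
          rw [le_div_iff₀ (hS.meanDuration_pos n a)] at h2
          linarith
      rw [Systems.dppRatio, div_le_iff₀ hD] at h1
      have h3 : 0 ≤ I ω * ((V * f + ∑ l, X.queue (X.time n k ω) ω l * g l)
          * S.meanDuration n (X.action n k ω) - (V * S.meanPenalty n (X.action n k ω)
            + ∑ l, X.queue (X.time n k ω) ω l * S.meanMetric n (X.action n k ω) l)) := by
        refine mul_nonneg ?_ (sub_nonneg.2 h1)
        simp only [hIdef]
        split_ifs <;> simp
      refine h3.trans (le_of_eq ?_)
      simp only [neg_mul, Finset.sum_neg_distrib, mul_assoc]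
      rw [← Finset.mul_sum]
      ring)
  have heq : ∀ ω, I ω * -V * framePenalty (X.frame n k ω)
      + ∑ l, -(I ω * X.queue (X.time n k ω) ω l) * frameMetric l (X.frame n k ω)
      - -(I ω * (V * f + ∑ l, X.queue (X.time n k ω) ω l * g l)) * ((X.frame n k ω).1 : ℝ)
      = -X.frozenTotal V f g n T k ω := by
    intro ω
    simp only [neg_mul, Finset.sum_neg_distrib, mul_assoc, frozenTotal]
    rw [← Finset.mul_sum]
    ring
  simp only [heq] at hint hnonneg
  refine ⟨by simpa using hint.neg, ?_⟩
  rw [integral_neg] at hnonneg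
  linarith

variable {X} in
/-- Over one frame, the drift-plus-penalty terms exceed those with frozen queues by at most a
multiple of the squared duration. -/
theorem BoundedAt.sum_frame_dppTerm_le {ω : Ω} (hω : X.BoundedAt ymax zmax dmax ω) {n : Fin N}
    (f : ℝ) {g : Fin L → ℝ} (hg : ∀ l, |g l| ≤ zmax)
    (hc : 0 ≤ zmax * L * (N * zmax + dmax)) (T k : ℕ) :
    (if X.time n k ω < T then ∑ i ∈ Finset.range (X.time n (k + 1) ω - X.time n k ω),
      X.dppTerm V f g n (X.time n k ω + i) ω else 0)
      ≤ X.frozenTotal V f g n T k ω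
        + zmax * L * (N * zmax + dmax) * ((X.frame n k ω).1 : ℝ) ^ 2 := by
  set t := X.time n k ω with ht
  set c := zmax * L * (N * zmax + dmax) with hcdef
  rw [frozenTotal]
  split_ifs with h
  · have h1 : ∀ i, X.dppTerm V f g n (t + i) ω ≤ (V * (X.penalty n (t + i) ω - f)
        + ∑ l, X.queue t ω l * (X.metric n (t + i) ω l - g l)) + c * (2 * i) := by
      intro i
      -- Cost of unfreezing the queues in slot `i` of the frame; the factor `2` comes from metric
      -- and reference each being bounded by `zmax`.
      have h2 := hω.sum_queue_sub_mul_le t i (x := fun l => X.metric n (t + i) ω l - g l)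
        fun l => (abs_sub _ _).trans (by linarith [(hω (t + i)).2.1 n l, hg l])
      simp only [sub_mul, Finset.sum_sub_distrib] at h2
      rw [dppTerm]
      linarith
    refine (Finset.sum_le_sum fun i _ => h1 i).trans ?_
    rw [Finset.sum_add_distrib, ← Finset.mul_sum, framePenalty_frame]
    simp only [frameMetric_frame, one_mul]
    refine add_le_add (le_of_eq ?_)
      (mul_le_mul_of_nonneg_left (sum_range_two_mul_le_sq _) hc)
    simp only [frame, mul_sub, Finset.sum_add_distrib, Finset.sum_sub_distrib, Finset.sum_const,
      Finset.card_range, nsmul_eq_mul, Finset.mul_sum, ← ht]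
    rw [Finset.sum_comm]
    linear_combination Finset.mul_sum Finset.univ (fun l => X.queue t ω l * g l)
      ((X.time n (k + 1) ω - t : ℕ) : ℝ)
  · rw [zero_mul, zero_add]
    positivity

variable {X} in
/-- The drift-plus-penalty terms of the slots from `T` on are bounded below in terms of the queues
at `T`. -/
theorem BoundedAt.neg_dppTerm_le {ω : Ω} (hω : X.BoundedAt ymax zmax dmax ω) (hV : 0 < V)
    {n : Fin N} {f : ℝ} {g : Fin L → ℝ} (hf : |f| ≤ ymax) (hg : ∀ l, |g l| ≤ zmax) (T i : ℕ) :
    -X.dppTerm V f g n (T + i) ω ≤ (2 * V * ymax + ∑ l, X.queue T ω l * (2 * zmax))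
      + zmax * L * (N * zmax + dmax) * (2 * i) := by
  have hz : ∀ l, |-(X.metric n (T + i) ω l - g l)| ≤ 2 * zmax := fun l => by
    rw [abs_neg]
    exact (abs_sub _ _).trans (by linarith [(hω (T + i)).2.1 n l, hg l])
  have h2 := hω.sum_queue_sub_mul_le T i hz
  have h3 : ∑ l, X.queue T ω l * -(X.metric n (T + i) ω l - g l)
      ≤ ∑ l, X.queue T ω l * (2 * zmax) := Finset.sum_le_sum fun l _ =>
    mul_le_mul_of_nonneg_left ((le_abs_self _).trans (hz l)) (X.queue_nonneg T ω l)
  have h4 : -(V * (X.penalty n (T + i) ω - f)) ≤ 2 * V * ymax := by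
    nlinarith [(abs_le.1 ((hω (T + i)).1 n)).1, (abs_le.1 hf).2]
  rw [dppTerm]
  simp only [sub_mul, Finset.sum_sub_distrib, mul_neg, Finset.sum_neg_distrib] at h2 h3
  linarith

variable {X} in
-- Slots before `T` are the started frames minus the overshoot. The overshoot meets queues of
-- possibly unbounded size, and its product with them is split by Young's inequality.
theorem BoundedAt.sum_dppTerm_le {ω : Ω} (hω : X.BoundedAt ymax zmax dmax ω) (hV : 0 < V)
    {n : Fin N} {f : ℝ} {g : Fin L → ℝ} (hf : |f| ≤ ymax) (hg : ∀ l, |g l| ≤ zmax)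
    (hc : 0 ≤ zmax * L * (N * zmax + dmax)) (T : ℕ) :
    ∑ t ∈ Finset.range T, X.dppTerm V f g n t ω
      ≤ ∑ k ∈ Finset.range T, (X.frozenTotal V f g n T k ω
          + zmax * L * (N * zmax + dmax) * ((X.frame n k ω).1 : ℝ) ^ 2)
        + 2 * V * ymax * (X.residual n T ω : ℝ)
        + (∑ l, X.queue T ω l ^ 2) / (4 * N)
        + (4 * N * L * zmax ^ 2 + zmax * L * (N * zmax + dmax)) * (X.residual n T ω : ℝ) ^ 2 := by
  have h1 := sum_started_frames (X.time_zero n ω) (X.strictMono_time n ω)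
    (fun t => X.dppTerm V f g n t ω) T
  have h2 := Finset.sum_le_sum fun k (_ : k ∈ Finset.range T) =>
    hω.sum_frame_dppTerm_le (V := V) (n := n) f hg hc T k
  have h3 := Finset.sum_le_sum fun i (_ : i ∈ Finset.range (X.residual n T ω)) =>
    hω.neg_dppTerm_le hV (n := n) hf hg T i
  rw [Finset.sum_neg_distrib, Finset.sum_add_distrib, ← Finset.mul_sum, Finset.sum_const,
    Finset.card_range, nsmul_eq_mul] at h3
  have h4 := mul_le_mul_of_nonneg_left (sum_range_two_mul_le_sq (X.residual n T ω)) hc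
  have hN : (0 : ℝ) < N := Nat.cast_pos.2 n.pos
  have h5 : (X.residual n T ω : ℝ) * ∑ l, X.queue T ω l * (2 * zmax)
      ≤ (∑ l, X.queue T ω l ^ 2) / (4 * N)
        + 4 * N * L * zmax ^ 2 * (X.residual n T ω : ℝ) ^ 2 := by
    -- The weight `1 / (4 * N)` is chosen so that the `N` systems together use only `Q ^ 2 / 4`,
    -- half of the Lyapunov term.
    have h6 : ∀ l ∈ Finset.univ, (X.residual n T ω : ℝ) * (X.queue T ω l * (2 * zmax))
        ≤ X.queue T ω l ^ 2 / (4 * N) + 4 * N * zmax ^ 2 * (X.residual n T ω : ℝ) ^ 2 := by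
      intro l _
      rw [div_add' _ _ _ (by positivity), le_div_iff₀ (by positivity)]
      nlinarith [sq_nonneg (X.queue T ω l - 4 * N * zmax * (X.residual n T ω : ℝ))]
    rw [Finset.mul_sum]
    refine (Finset.sum_le_sum h6).trans (le_of_eq ?_)
    rw [Finset.sum_add_distrib, Finset.sum_div]
    simp only [Finset.sum_const, Finset.card_univ, Fintype.card_fin, nsmul_eq_mul]
    ring
  rw [h1] at h2
  change _ + ∑ i ∈ Finset.range (X.residual n T ω), X.dppTerm V f g n (T + i) ω ≤ _ at h2
  linarith

theorem integral_sum_dppTerm_le [IsProbabilityMeasure P] (hS : S.Bounded ymax zmax dmax B)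
    (hV : 0 < V) (hX : X.FollowsAlgorithm V) {n : Fin N} {f : ℝ} {g : Fin L → ℝ}
    (hf : |f| ≤ ymax) (hg : ∀ l, |g l| ≤ zmax) (hfg : ∀ (c m : ℝ) (w : Fin L → ℝ),
      (∀ a, 0 ≤ c * S.meanPenalty n a + ∑ l, w l * S.meanMetric n a l
        - m * S.meanDuration n a) → m ≤ c * f + ∑ l, w l * g l)
    (hc : 0 ≤ zmax * L * (N * zmax + dmax)) (T : ℕ) :
    ∑ t ∈ Finset.range T, ∫ ω, X.dppTerm V f g n t ω ∂P
      ≤ T * (zmax * L * (N * zmax + dmax) * B) + 2 * V * ymax * B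
        + (∑ l, ∫ ω, X.queue T ω l ^ 2 ∂P) / (4 * N)
        + (4 * N * L * zmax ^ 2 + zmax * L * (N * zmax + dmax)) * B := by
  set c := zmax * L * (N * zmax + dmax) with hcdef
  have hF := fun k => X.integral_frozenTotal_nonpos hS hX hfg T k
  have hD := fun k => X.integrable_duration_sq hS n k
  have i1 : ∀ k, Integrable (fun ω => X.frozenTotal V f g n T k ω
      + c * ((X.frame n k ω).1 : ℝ) ^ 2) P := fun k => (hF k).1.add ((hD k).1.const_mul c)
  have e1 : ∀ k ∈ Finset.range T, ∫ ω, (X.frozenTotal V f g n T k ω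
      + c * ((X.frame n k ω).1 : ℝ) ^ 2) ∂P ≤ c * B := fun k _ => by
    rw [integral_add (hF k).1 ((hD k).1.const_mul c), integral_const_mul]
    have := mul_le_mul_of_nonneg_left (hD k).2 hc
    linarith [(hF k).2]
  have hr := X.integrable_residual hS n T
  have hr2 := X.integrable_residual_sq hS n T
  have i2 : Integrable (fun ω => ∑ k ∈ Finset.range T, (X.frozenTotal V f g n T k ω
      + c * ((X.frame n k ω).1 : ℝ) ^ 2)) P := integrable_finsetSum _ fun k _ => i1 k
  have i3 : Integrable (fun ω => 2 * V * ymax * (X.residual n T ω : ℝ)) P := hr.1.const_mul _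
  have i4 : Integrable (fun ω => (∑ l, X.queue T ω l ^ 2) / (4 * N)) P :=
    (integrable_finsetSum _ fun l _ => X.integrable_queue_sq hS T l).div_const _
  have i5 : Integrable (fun ω => (4 * N * L * zmax ^ 2 + c) * (X.residual n T ω : ℝ) ^ 2) P :=
    hr2.1.const_mul _
  have i23 : Integrable (fun ω => ∑ k ∈ Finset.range T, (X.frozenTotal V f g n T k ω
      + c * ((X.frame n k ω).1 : ℝ) ^ 2) + 2 * V * ymax * (X.residual n T ω : ℝ)) P := i2.add i3
  have i234 : Integrable (fun ω => ∑ k ∈ Finset.range T, (X.frozenTotal V f g n T k ω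
      + c * ((X.frame n k ω).1 : ℝ) ^ 2) + 2 * V * ymax * (X.residual n T ω : ℝ)
      + (∑ l, X.queue T ω l ^ 2) / (4 * N)) P := i23.add i4
  have hmono := integral_mono_ae
    (integrable_finsetSum (Finset.range T) fun t _ => X.integrable_dppTerm (V := V) hS f g n t)
    (i234.add i5) ((X.ae_boundedAt hS).mono fun ω hω => hω.sum_dppTerm_le hV hf hg hc T)
  simp only [Pi.add_apply] at hmono
  rw [integral_finsetSum _ fun t _ => X.integrable_dppTerm hS f g n t, integral_add i234 i5,
    integral_add i23 i4, integral_add i2 i3, integral_finsetSum _ fun k _ => i1 k,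
    integral_const_mul, integral_const_mul, integral_div,
    integral_finsetSum _ fun l _ => X.integrable_queue_sq hS T l] at hmono
  have h1 := Finset.sum_le_sum e1
  rw [Finset.sum_const, Finset.card_range, nsmul_eq_mul] at h1
  have hy : 0 ≤ ymax := (abs_nonneg _).trans hf
  have h2 := mul_le_mul_of_nonneg_left hr.2 (show 0 ≤ 2 * V * ymax by positivity)
  have h3 := mul_le_mul_of_nonneg_left hr2.2 (show 0 ≤ 4 * N * L * zmax ^ 2 + c by positivity)
  linarith

end Realization

/-! ### Summing over the systems -/

namespace Realization

variable {N L : ℕ} {S : Systems.{u} N L} {Ω : Type v} [mΩ : MeasurableSpace Ω] {P : Measure Ω}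
  (X : Realization S P) {ymax zmax dmax B V : ℝ}

/-- The signs of the constants are not assumed; they follow from the almost sure bounds once there
is a system and a metric. -/
theorem zmax_mul_arrival_bound_nonneg [IsProbabilityMeasure P] {X : Realization S P}
    (hS : S.Bounded ymax zmax dmax B) (n : Fin N) : 0 ≤ zmax * L * (N * zmax + dmax) := by
  rcases Nat.eq_zero_or_pos L with rfl | hL
  · simp
  obtain ⟨ω, hω⟩ := (X.ae_boundedAt hS).exists
  have h1 : 0 ≤ zmax := (abs_nonneg _).trans ((hω 0).2.1 n ⟨0, hL⟩)
  have h2 : 0 ≤ N * zmax + dmax := (abs_nonneg _).trans (hω.abs_arrival_le 0 ⟨0, hL⟩)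
  positivity

theorem integral_queue_mul_arrival [IsProbabilityMeasure P] (hS : S.Bounded ymax zmax dmax B)
    (t : ℕ) (l : Fin L) :
    Integrable (fun ω => X.queue t ω l * (∑ n, X.metric n t ω l - X.ext t ω l)) P ∧
    ∫ ω, X.queue t ω l * (∑ n, X.metric n t ω l - X.ext t ω l) ∂P
      = ∑ n, ∫ ω, X.queue t ω l * X.metric n t ω l ∂P
        - (∫ ω, X.queue t ω l ∂P) * S.extMean l := by
  have h1 := fun n => X.integrable_queue_mul hS t l (X.integrable_metric hS n t l)
  have h2 : Integrable (fun ω => ∑ n, X.queue t ω l * X.metric n t ω l) P :=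
    integrable_finsetSum _ fun n _ => h1 n
  have h3 := X.integrable_queue_mul hS t l (X.integrable_ext hS t l)
  simp only [mul_sub, Finset.mul_sum]
  refine ⟨h2.sub h3, ?_⟩
  rw [integral_sub h2 h3, integral_finsetSum _ fun n _ => h1 n, integral_queue_mul_ext]

theorem integral_dppTerm [IsProbabilityMeasure P] (hS : S.Bounded ymax zmax dmax B) (f : ℝ)
    (g : Fin L → ℝ) (n : Fin N) (t : ℕ) :
    ∫ ω, X.dppTerm V f g n t ω ∂P = V * (∫ ω, X.penalty n t ω ∂P - f)
      + ∑ l, (∫ ω, X.queue t ω l * X.metric n t ω l ∂P - (∫ ω, X.queue t ω l ∂P) * g l) := by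
  have h1 : Integrable (fun ω => V * (X.penalty n t ω - f)) P :=
    ((X.integrable_penalty hS n t).sub (integrable_const f)).const_mul V
  have h2 := fun l => X.integrable_queue_mul hS t l (X.integrable_metric hS n t l)
  have h3 := fun l => (X.integrable_queue hS t l).mul_const (g l)
  have h4 := fun l => (h2 l).sub (h3 l)
  simp only [dppTerm, mul_sub] at h1 ⊢
  simp only [Pi.sub_def] at h4
  rw [integral_add h1 (integrable_finsetSum _ fun l _ => h4 l),
    integral_finsetSum _ fun l _ => h4 l,
    integral_sub ((X.integrable_penalty hS n t).const_mul V) (integrable_const _),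
    integral_const_mul]
  congr 1
  · simp
  · refine Finset.sum_congr rfl fun l _ => ?_
    rw [integral_sub (h2 l) (h3 l), integral_mul_const]

/-- Drift-plus-penalty bound: the accumulated penalties together with a quarter of the second
moments of the queues grow at most linearly, at a rate given by any reference performance. -/
theorem exists_penalty_add_queue_sq_le [IsProbabilityMeasure P]
    (hS : S.Bounded ymax zmax dmax B) (hV : 0 < V) (hX : X.FollowsAlgorithm V) {f : Fin N → ℝ}
    {g : Fin N → Fin L → ℝ} (hf : ∀ n, |f n| ≤ ymax) (hg : ∀ n l, |g n l| ≤ zmax)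
    (hfg : ∀ (n : Fin N) (c m : ℝ) (w : Fin L → ℝ),
      (∀ a, 0 ≤ c * S.meanPenalty n a + ∑ l, w l * S.meanMetric n a l
        - m * S.meanDuration n a) → m ≤ c * f n + ∑ l, w l * g n l)
    (hgd : ∀ l, ∑ n, g n l ≤ S.extMean l) :
    ∃ K, ∀ T : ℕ, V * ∑ t ∈ Finset.range T, ∑ n, ∫ ω, X.penalty n t ω ∂P
      + (∑ l, ∫ ω, X.queue T ω l ^ 2 ∂P) / 4
      ≤ T * ((N * zmax + dmax) ^ 2 * L / 2 + N * (zmax * L * (N * zmax + dmax) * B)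
        + V * ∑ n, f n) + K := by
  -- The constant collects the overshoot costs of the `N` systems, which do not grow with `T`.
  refine ⟨N * (2 * V * ymax * B
    + (4 * N * L * zmax ^ 2 + zmax * L * (N * zmax + dmax)) * B), fun T => ?_⟩
  have i1 : ∀ t, Integrable (fun ω => ∑ l,
      X.queue t ω l * (∑ n, X.metric n t ω l - X.ext t ω l)) P := fun t =>
    integrable_finsetSum _ fun l _ => (X.integral_queue_mul_arrival hS t l).1
  have i2 := integrable_finsetSum (Finset.range T) fun t _ => i1 t
  have drift := integral_mono_ae
    (integrable_finsetSum Finset.univ fun l _ => (X.integrable_queue_sq hS T l).div_const 2)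
    (i2.add (integrable_const (T * ((N * zmax + dmax) ^ 2 * L / 2))))
    ((X.ae_boundedAt hS).mono fun ω hω => hω.queue_sq_le T)
  simp only [Pi.add_apply] at drift
  rw [integral_finsetSum _ fun l _ => (X.integrable_queue_sq hS T l).div_const 2,
    integral_add i2 (integrable_const _), integral_finsetSum _ fun t _ => i1 t, integral_const,
    probReal_univ, one_smul] at drift
  simp only [integral_div, ← Finset.sum_div] at drift
  have slot : ∀ t ∈ Finset.range T,
      ∫ ω, ∑ l, X.queue t ω l * (∑ n, X.metric n t ω l - X.ext t ω l) ∂P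
        + V * ∑ n, ∫ ω, X.penalty n t ω ∂P
      ≤ ∑ n, ∫ ω, X.dppTerm V (f n) (g n) n t ω ∂P + V * ∑ n, f n := by
    intro t _
    rw [integral_finsetSum _ fun l _ => (X.integral_queue_mul_arrival hS t l).1,
      Finset.sum_congr rfl fun l _ => (X.integral_queue_mul_arrival hS t l).2,
      Finset.sum_congr rfl fun n _ => X.integral_dppTerm hS (V := V) (f n) (g n) n t,
      Finset.sum_add_distrib, Finset.sum_comm (γ := Fin N)]
    -- The reference satisfies the constraints and the queues are nonnegative: replacing the
    -- external mean by the reference metrics only increases the drift bound.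
    have h1 : ∑ l, (∫ ω, X.queue t ω l ∂P) * ∑ n, g n l
        ≤ ∑ l, (∫ ω, X.queue t ω l ∂P) * S.extMean l := Finset.sum_le_sum fun l _ =>
      mul_le_mul_of_nonneg_left (hgd l) (integral_nonneg fun ω => X.queue_nonneg t ω l)
    simp only [Finset.sum_sub_distrib, ← Finset.mul_sum]
    linarith
  have slots := Finset.sum_le_sum slot
  rw [Finset.sum_add_distrib, Finset.sum_add_distrib, ← Finset.mul_sum, Finset.sum_const,
    Finset.card_range, nsmul_eq_mul, Finset.sum_comm (s := Finset.range T)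
      (t := Finset.univ) (f := fun t n => ∫ ω, X.dppTerm V (f n) (g n) n t ω ∂P)] at slots
  have systems := Finset.sum_le_sum fun n (_ : n ∈ Finset.univ) =>
    X.integral_sum_dppTerm_le hS hV hX (hf n) (hg n) (hfg n)
      (X.zmax_mul_arrival_bound_nonneg hS n) T
  rw [Finset.sum_const, Finset.card_univ, Fintype.card_fin, nsmul_eq_mul] at systems
  -- For `N = 0` the left side is zero, hence an inequality and not an equality.
  have hq : (N : ℝ) * ((∑ l, ∫ ω, X.queue T ω l ^ 2 ∂P) / (4 * N))
      ≤ (∑ l, ∫ ω, X.queue T ω l ^ 2 ∂P) / 4 := by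
    rcases Nat.eq_zero_or_pos N with h | h
    · subst h
      simp only [Nat.cast_zero, zero_mul]
      exact div_nonneg (Finset.sum_nonneg fun l _ => integral_nonneg fun ω => sq_nonneg _)
        zero_le_four
    · have : (N : ℝ) ≠ 0 := by positivity
      exact le_of_eq (by field_simp)
  linarith

/-! ### Mean rate stability and the constraints -/

theorem sq_integral_queue_le [IsProbabilityMeasure P] (hS : S.Bounded ymax zmax dmax B) (T : ℕ)
    (l : Fin L) : (∫ ω, X.queue T ω l ∂P) ^ 2 ≤ ∑ l, ∫ ω, X.queue T ω l ^ 2 ∂P := by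
  have h1 : MemLp (fun ω => X.queue T ω l) 2 P :=
    (memLp_two_iff_integrable_sq (X.measurable_queue T l).aestronglyMeasurable).2
      (X.integrable_queue_sq hS T l)
  have h2 := variance_nonneg (fun ω => X.queue T ω l) P
  rw [variance_eq_sub h1] at h2
  have h3 := Finset.single_le_sum (f := fun l => ∫ ω, X.queue T ω l ^ 2 ∂P)
    (fun l _ => integral_nonneg fun ω => sq_nonneg _) (Finset.mem_univ l)
  simp only [Pi.pow_apply] at h2 h3
  linarith

/-- A linear bound on the second moments of the queues makes them mean rate stable. -/
theorem tendsto_integral_queue_div [IsProbabilityMeasure P] (hS : S.Bounded ymax zmax dmax B)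
    {D K : ℝ} (h : ∀ T : ℕ, ∑ l, ∫ ω, X.queue T ω l ^ 2 ∂P ≤ T * D + K) (l : Fin L) :
    Tendsto (fun T : ℕ => (∫ ω, X.queue T ω l ∂P) / (T : ℝ)) atTop (𝓝 0) := by
  -- The squared mean is at most the second moment, so the squared ratio is `O(1 / T)`.
  have h1 : Tendsto (fun T : ℕ => ((∫ ω, X.queue T ω l ∂P) / (T : ℝ)) ^ 2) atTop (𝓝 0) := by
    refine squeeze_zero' (Eventually.of_forall fun T => sq_nonneg _) ?_
      (tendsto_const_div_atTop_nhds_zero_nat (D + |K|))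
    filter_upwards [eventually_ge_atTop 1] with T hT
    have hT' : (1 : ℝ) ≤ T := by exact_mod_cast hT
    rw [div_pow, div_le_div_iff₀ (by positivity) (by positivity)]
    have h2 := (X.sq_integral_queue_le hS T l).trans (h T)
    have h3 : K ≤ T * |K| := (le_abs_self K).trans (le_mul_of_one_le_left (abs_nonneg K) hT')
    have h4 : (∫ ω, X.queue T ω l ∂P) ^ 2 ≤ (D + |K|) * T := by linarith
    calc _ ≤ ((D + |K|) * T) * T := mul_le_mul_of_nonneg_right h4 (by positivity)
      _ = _ := by ring
  have h2 := h1.sqrt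
  rw [Real.sqrt_zero] at h2
  refine h2.congr fun T => Real.sqrt_sq ?_
  exact div_nonneg (integral_nonneg fun ω => X.queue_nonneg T ω l) (Nat.cast_nonneg T)

theorem limsup_coe_le_of_tendsto {a b : ℕ → ℝ} {x : ℝ} (hb : Tendsto b atTop (𝓝 x))
    (hab : ∀ᶠ T in atTop, a T ≤ b T) : limsup (fun T => (a T : EReal)) atTop ≤ x := by
  have h1 : Tendsto (fun T => (b T : EReal)) atTop (𝓝 (x : EReal)) :=
    (continuous_coe_real_ereal.tendsto x).comp hb
  rw [← h1.limsup_eq]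
  exact limsup_le_limsup (hab.mono fun T hT => EReal.coe_le_coe_iff.2 hT)

/-- Mean rate stable queues imply the constraints. -/
theorem avgMetric_le_of_tendsto [IsProbabilityMeasure P] (hS : S.Bounded ymax zmax dmax B)
    {l : Fin L} (h : Tendsto (fun T : ℕ => (∫ ω, X.queue T ω l ∂P) / (T : ℝ)) atTop (𝓝 0)) :
    X.avgMetric l ≤ (S.extMean l : EReal) := by
  have h1 := h.const_add (S.extMean l)
  rw [add_zero] at h1
  refine limsup_coe_le_of_tendsto h1 ?_
  filter_upwards [eventually_gt_atTop 0] with T hT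
  have hT' : (0 : ℝ) < T := Nat.cast_pos.2 hT
  have i1 : ∀ t, Integrable (fun ω => ∑ n, X.metric n t ω l) P := fun t =>
    integrable_finsetSum _ fun n _ => X.integrable_metric hS n t l
  have i2 : ∀ t, Integrable (fun ω => ∑ n, X.metric n t ω l - X.ext t ω l) P := fun t =>
    (i1 t).sub (X.integrable_ext hS t l)
  have h2 := integral_mono (integrable_finsetSum (Finset.range T) fun t _ => i2 t)
    (X.integrable_queue hS T l) fun ω => X.sum_sub_le_queue T ω l
  rw [integral_finsetSum _ fun t _ => i2 t, Finset.sum_congr rfl fun t _ =>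
    (integral_sub (i1 t) (X.integrable_ext hS t l)).trans (by
      rw [integral_finsetSum _ fun n _ => X.integrable_metric hS n t l, X.integral_ext]),
    Finset.sum_sub_distrib, Finset.sum_const, Finset.card_range, nsmul_eq_mul] at h2
  rw [one_div, inv_mul_le_iff₀ hT', mul_add, mul_div_cancel₀ _ hT'.ne']
  linarith

end Realization

end AsyncRenewal

end

/-! ### The main theorem -/

theorem mainTheorem1 {N L : ℕ} (S : AsyncRenewal.Systems.{u} N L)
    (hfeasible : S.feasibleValues.Nonempty)
    (ymax zmax dmax B : ℝ) (hbounded : S.Bounded ymax zmax dmax B)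
    (hcompact : ∀ n, IsCompact (Set.range (S.performance n)))
    (V : ℝ) (hV : 0 < V)
    {Ω : Type v} [MeasurableSpace Ω] (P : Measure Ω) [IsProbabilityMeasure P]
    (X : AsyncRenewal.Realization S P) (hX : X.FollowsAlgorithm V)
    (C₁ C₃ : ℝ) (hC₁ : C₁ = 6 * L * zmax * (N * zmax + dmax) * B)
    (hC₃ : C₃ = (N * zmax + dmax) ^ 2 * L / 2) :
    (∀ l, Tendsto (fun T : ℕ => (∫ ω, X.queue T ω l ∂P) / (T : ℝ)) atTop (𝓝 0)) ∧
    (∀ l, X.avgMetric l ≤ (S.extMean l : EReal)) ∧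
    X.avgPenalty ≤ S.optimalValue + (((N * C₁ + C₃) / V : ℝ) : EReal) := by
  -- The comparison is made with each feasible value separately, so the infimum need not be
  -- attained. Stability needs just one feasible reference.
  have key : ∀ v ∈ S.feasibleValues, (∀ l, Tendsto (fun T : ℕ =>
      (∫ ω, X.queue T ω l ∂P) / (T : ℝ)) atTop (𝓝 0)) ∧
      X.avgPenalty ≤ v + (((N * C₁ + C₃) / V : ℝ) : EReal) := by
    rintro _ ⟨Ω', _, P', _, X', hX', rfl⟩
    obtain ⟨f, g, hfv, hgv, hf, hg, hfg⟩ := X'.exists_limit_performance hbounded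
    have hgd : ∀ l, ∑ n, g n l ≤ S.extMean l := fun l =>
      EReal.coe_le_coe_iff.1 ((hgv l).trans (hX' l))
    obtain ⟨K, hK⟩ := X.exists_penalty_add_queue_sq_le hbounded hV hX hf hg hfg hgd
    set A := (N * zmax + dmax) ^ 2 * L / 2 + N * (zmax * L * (N * zmax + dmax) * B) with hA
    -- The argument gives the rate with `C₁ / 6` in place of `C₁`.
    have hAC : A ≤ N * C₁ + C₃ := by
      have h1 : N * (zmax * L * (N * zmax + dmax) * B) ≤ N * C₁ := by
        rcases Nat.eq_zero_or_pos N with h | h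
        · subst h
          simp
        · refine mul_le_mul_of_nonneg_left ?_ (Nat.cast_nonneg N)
          have h2 := X.zmax_mul_arrival_bound_nonneg hbounded ⟨0, h⟩
          have h3 := mul_nonneg h2 (zero_le_one.trans hbounded.one_le)
          rw [hC₁]
          linarith
      rw [hA, hC₃]
      linarith
    refine ⟨fun l => X.tendsto_integral_queue_div hbounded
      -- The last term of `D` pays for the mean penalties, which are at least `-(N * ymax)` per
      -- slot; the factor `4` clears the quarter in front of the queues.
      (D := 4 * (A + V * ∑ n, f n + V * (N * ymax))) (K := 4 * K) (fun T => ?_) l, ?_⟩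
    · have h1 : -(T * (N * ymax)) ≤ ∑ t ∈ Finset.range T, ∑ n, ∫ ω, X.penalty n t ω ∂P := by
        have h2 := Finset.sum_le_sum fun t (_ : t ∈ Finset.range T) => Finset.sum_le_sum
          fun n (_ : n ∈ Finset.univ) => (abs_le.1 (X.abs_integral_penalty_le hbounded n t)).1
        simpa using h2
      have h3 := mul_le_mul_of_nonneg_left h1 hV.le
      have h4 := hK T
      linarith
    · have hlim : Tendsto (fun T : ℕ => (∑ n, f n + A / V) + K / V / (T : ℝ)) atTop
          (𝓝 ((∑ n, f n + A / V) + 0)) :=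
        (tendsto_const_div_atTop_nhds_zero_nat (K / V)).const_add _
      rw [add_zero] at hlim
      have h1 : X.avgPenalty ≤ ((∑ n, f n + A / V : ℝ) : EReal) := by
        refine AsyncRenewal.Realization.limsup_coe_le_of_tendsto hlim ?_
        filter_upwards [eventually_gt_atTop 0] with T hT
        have hT' : (0 : ℝ) < T := Nat.cast_pos.2 hT
        have h2 : 0 ≤ ∑ l, ∫ ω, X.queue T ω l ^ 2 ∂P :=
          Finset.sum_nonneg fun l _ => integral_nonneg fun ω => sq_nonneg _
        have h3 := hK T
        rw [one_div, inv_mul_le_iff₀ hT', mul_add, mul_div_cancel₀ _ hT'.ne']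
        refine le_of_mul_le_mul_left (a := V) ?_ hV
        have h4 : V * (T * (∑ n, f n + A / V) + K / V) = T * (A + V * ∑ n, f n) + K := by
          field_simp
          ring
        linarith
      refine h1.trans ?_
      rw [EReal.coe_add]
      exact add_le_add hfv (EReal.coe_le_coe_iff.2 (div_le_div_of_nonneg_right hAC hV.le))
  obtain ⟨v, hv⟩ := hfeasible
  refine ⟨(key v hv).1, fun l => X.avgMetric_le_of_tendsto hbounded ((key v hv).1 l), ?_⟩
  have h1 : X.avgPenalty - (((N * C₁ + C₃) / V : ℝ) : EReal) ≤ S.optimalValue :=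
    le_sInf fun w hw => EReal.sub_le_of_le_add (key w hw).2
  exact (EReal.sub_le_iff_le_add (Or.inl (EReal.coe_ne_bot _)) (Or.inl (EReal.coe_ne_top _))).1 h1
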